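/- Setting. Let $\Omega$ be the space of continuous paths $\omega:[0,\infty)\to\mathbb R^d$ with $\omega_0=0$ (topology of locally uniform convergence, Borel $\sigma$-algebra) and $B_t(\omega)=\omega_t$ the canonical process. Let $\Sigma$ be a nonempty, convex, closed set of symmetric $d\times d$ matrices with $\underline\sigma I\le\sigma\le\overline\sigma I$ for all $\sigma\in\Sigma$, where $0<\underline\sigma\le\overline\sigma<\infty$, and let $G(A)=\frac12\sup_{\sigma\in\Sigma}\sum_{i,j}A_{ij}\sigma_{ij}$. Let $\mathbb E^G$ be the $G$-expectation, i.e. the sublinear expectation under which $(B_t)_{t\ge 0}$ is a $G$-Brownian motion (stationary independent increments, $\mathbb E^G(B_t)=-\mathbb E^G(-B_t)=0$, $B_1$ $G$-normally distributed with $G(A)=\frac12\mathbb E^G((AB_1,B_1))$), and let $\mathcal P$ be a weakly compact family of Borel probability measures on $\Omega$ representing it: $\mathbb E^G(X)=\sup_{P\in\mathcal P}E_P(X)$ for bounded Lipschitz cylinder functionals $X$, and hence on the completion $L^1_G(\Omega)$ of the space of such functionals under the norm $\sup_{P\in\mathcal P}E_P|\cdot|$. Put $\overline{\mathbb E}^G(X)=\sup_{P\in\mathcal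 P}E_P(X)$ for Borel $X\ge 0$, and $c^G(A)=\sup_{P\in\mathcal P}P(A)$. A map $X$ on $\Omega$ is quasi-continuous if for every $\delta>0$ there is an open $O$ with $c^G(O)<\delta$ such that $X|_{O^c}$ is continuous. Statement. Let $T>0$, let $\Lambda$ be an index set, and let $\{Y_{\lambda,\epsilon}(t),\,t\in[0,T]^m\}$, $\lambda\in\Lambda$, $\epsilon\in[0,1]$, be $\mathbb R^p$-valued random fields on $\Omega$ with continuous sample paths, such that $Y_{\lambda,\epsilon}(t)$ is quasi-continuous for all $\lambda,\epsilon,t$. Write $Y_\lambda=Y_{\lambda,0}$. Assume that there are constants $C$, $q>0$ and $\kappa>0$ such that $$\sup_{\lambda\in\Lambda,\,\epsilon\in[0,1]}\overline{\mathbb E}^G\big(|Y_{\lambda,\epsilon}(t)-Y_{\lambda,\epsilon}(s)|^q\big)\le C|t-s|^{m+\kappa},\qquad s,t\in[0,T]^m .$$ (1) For every $\alpha\in[0,\kappa/q)$, $$\sup_{\lambda\in\Lambda,\,\epsilon\in[0,1]}\overline{\mathbb E}^G\left(\Big(\sup_{s\ne t}\frac{|Y_{\lambda,\epsilon}(t)-Y_{\lambda,\epsilon}(s)|}{|t-s|^\alpha}\Big)^q\right)<\infty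 .$$ (2) If for some $t_0\in[0,T]^m$ the values at $t_0$ are tight, i.e. $\lim_{R\to\infty}\sup_{\lambda\in\Lambda,\epsilon\in[0,1]}c^G(|Y_{\lambda,\epsilon}(t_0)|>R)=0$, then the family is tight: for every $\delta>0$ there is a compact $K_\delta\subset C([0,T]^m,\mathbb R^p)$ with $\sup_{\lambda\in\Lambda,\epsilon\in[0,1]}c^G(Y_{\lambda,\epsilon}\notin K_\delta)<\delta$. (3) Suppose that for some $t_0\in[0,T]^m$ the limits satisfy $\lim_{R\to\infty}\sup_{\lambda\in\Lambda}c^G(|Y_\lambda(t_0)|>R)=0$, and that for every $t\in[0,T]^m$ and every $\delta>0$ $$\lim_{\epsilon\to0}\sup_{\lambda\in\Lambda}c^G\big(|Y_{\lambda,\epsilon}(t)-Y_\lambda(t)|\ge\delta\big)=0 .$$ Then for every bounded continuous $\Phi:C([0,T]^m,\mathbb R^p)\to\mathbb R$ one has $|\Phi(Y_{\lambda,\epsilon})-\Phi(Y_\lambda)|\in L^1_G(\Omega)$ for all $\lambda,\epsilon$, and $$\lim_{\epsilon\to0}\sup_{\lambda\in\Lambda}\mathbb E^G\big(|\Phi(Y_{\lambda,\epsilon})-\Phi(Y_\lambda)|\big)=0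 .$$ -/

import Mathlib

open MeasureTheory Filter Topology Set
open scoped NNReal ENNReal BoundedContinuousFunction

/-- The space `Ω` of continuous paths `ω : [0, ∞) → ℝ^d` with `ω 0 = 0`. -/
def PathSpace (d : ℕ) : Type :=
  {ω : C(ℝ≥0, EuclideanSpace ℝ (Fin d)) // ω 0 = 0}

/-- The topology of locally uniform convergence (compact-open topology). -/
instance PathSpace.instTopologicalSpace (d : ℕ) : TopologicalSpace (PathSpace d) :=
  inferInstanceAs
    (TopologicalSpace {ω : C(ℝ≥0, EuclideanSpace ℝ (Fin d)) // ω 0 = 0})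

/-- The Borel `σ`-algebra of `Ω`. -/
instance PathSpace.instMeasurableSpace (d : ℕ) : MeasurableSpace (PathSpace d) :=
  borel (PathSpace d)

instance PathSpace.instBorelSpace (d : ℕ) : BorelSpace (PathSpace d) := ⟨rfl⟩

/-- The canonical process `B_t(ω) = ω_t`. -/
def canon {d : ℕ} (t : ℝ≥0) (ω : PathSpace d) : EuclideanSpace ℝ (Fin d) := ω.1 t

/-- `lip(E)`: bounded Lipschitz functions. -/
def IsBddLip {E : Type*} [PseudoMetricSpace E] (φ : E → ℝ) : Prop :=
  (∃ M : ℝ, ∀ x, |φ x| ≤ M) ∧ ∃ K : ℝ≥0, LipschitzWith K φ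

/-- `L_ip(Ω)`: functionals `φ(ω_{t_1}, …, ω_{t_n})` with `φ` bounded and Lipschitz. -/
def IsLip {d : ℕ} (X : PathSpace d → ℝ) : Prop :=
  ∃ (n : ℕ) (t : Fin n → ℝ≥0) (φ : (Fin n → EuclideanSpace ℝ (Fin d)) → ℝ),
    IsBddLip φ ∧ X = fun ω => φ (fun i => canon (t i) ω)

/-- `sup_{P ∈ 𝒬} E_P(X)` for `[0, ∞]`-valued `X`: the upper expectation. -/
noncomputable def upperExp {d : ℕ} (𝒬 : Set (ProbabilityMeasure (PathSpace d)))
    (X : PathSpace d → ℝ≥0∞) : ℝ≥0∞ :=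
  ⨆ P ∈ 𝒬, ∫⁻ ω, X ω ∂(P : Measure (PathSpace d))

/-- The Choquet capacity `c(A) = sup_{P ∈ 𝒬} P(A)`. -/
noncomputable def capacity {d : ℕ} (𝒬 : Set (ProbabilityMeasure (PathSpace d)))
    (A : Set (PathSpace d)) : ℝ≥0∞ :=
  ⨆ P ∈ 𝒬, (P : Measure (PathSpace d)) A

/-- `X` is quasi-continuous: for every `δ > 0` there is an open set `O` of capacity less than `δ`
such that the restriction of `X` to the complement of `O` is continuous. -/
def QuasiContinuous {d : ℕ} (𝒬 : Set (ProbabilityMeasure (PathSpace d)))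
    {S : Type*} [TopologicalSpace S] (X : PathSpace d → S) : Prop :=
  ∀ δ : ℝ≥0∞, 0 < δ → ∃ O : Set (PathSpace d), IsOpen O ∧ capacity 𝒬 O < δ ∧ ContinuousOn X Oᶜ

/-- `L^1_G(Ω)`: the completion of `L_ip(Ω)` under the norm `sup_{P ∈ 𝒬} E_P|·|`, realised as a
space of Borel functions on `Ω`. -/
def MemLG {d : ℕ} (𝒬 : Set (ProbabilityMeasure (PathSpace d))) (X : PathSpace d → ℝ) : Prop :=
  Measurable X ∧ ∃ Z : ℕ → PathSpace d → ℝ, (∀ n, IsLip (Z n)) ∧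
    Tendsto (fun n => upperExp 𝒬 (fun ω => ENNReal.ofReal |Z n ω - X ω|)) atTop (𝓝 0)

/-- `sup_{P ∈ 𝒬} E_P(X)` as a real number. When `𝒬` represents the `G`-expectation this is
`E^G(X)` for `X ∈ L_ip(Ω)`, and its continuous extension for `X ∈ L^1_G(Ω)`. -/
noncomputable def gExp {d : ℕ} (𝒬 : Set (ProbabilityMeasure (PathSpace d)))
    (X : PathSpace d → ℝ) : ℝ :=
  ⨆ P : 𝒬, ∫ ω, X ω ∂((P : ProbabilityMeasure (PathSpace d)) : Measure (PathSpace d))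

/-- A set `S` of admissible covariance matrices: nonempty, convex, closed, and contained in
`{σ symmetric : lo * I ≤ σ ≤ up * I}` for some `0 < lo ≤ up < ∞`. -/
structure IsCovarianceSet {d : ℕ} (S : Set (Matrix (Fin d) (Fin d) ℝ)) : Prop where
  nonempty : S.Nonempty
  convex : Convex ℝ S
  isClosed : IsClosed S
  bounds : ∃ lo up : ℝ, 0 < lo ∧ lo ≤ up ∧ ∀ σ ∈ S,
    (σ - lo • (1 : Matrix (Fin d) (Fin d) ℝ)).PosSemidef ∧
      (up • (1 : Matrix (Fin d) (Fin d) ℝ) - σ).PosSemidef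

/-- `G(A) = (1/2) sup_{σ ∈ S} (A, σ)`, with `(A, σ) = ∑_{i,j} A_{ij} σ_{ij}`. -/
noncomputable def gFun {d : ℕ} (S : Set (Matrix (Fin d) (Fin d) ℝ))
    (A : Matrix (Fin d) (Fin d) ℝ) : ℝ :=
  (1 / 2) * ⨆ σ : S, ∑ i, ∑ j, A i j * (σ : Matrix (Fin d) (Fin d) ℝ) i j

/-- `𝒬` is a weakly compact family of probability measures on `Ω` that represents the
`G`-expectation, for the function `G` given by the set `S`. That is, under the sublinear
expectation `X ↦ sup_{P ∈ 𝒬} E_P(X)` the canonical process is a `G`-Brownian motion: it has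
stationary independent increments and mean zero without mean uncertainty, and `B_1` is
`G`-normally distributed. (That it is continuous and starts at `0` is built into `Ω`.) -/
structure RepresentsGExpectation {d : ℕ} (S : Set (Matrix (Fin d) (Fin d) ℝ))
    (𝒬 : Set (ProbabilityMeasure (PathSpace d))) : Prop where
  nonempty : 𝒬.Nonempty
  isCompact : IsCompact 𝒬
  /-- `E(B_t) = -E(-B_t) = 0`. -/
  mean_zero : ∀ (t : ℝ≥0) (i : Fin d), MemLG 𝒬 (fun ω => canon t ω i) ∧
    gExp 𝒬 (fun ω => canon t ω i) = 0 ∧ gExp 𝒬 (fun ω => -canon t ω i) = 0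
  /-- The increment `B_{s+h} - B_s` is independent of `(B_{t_1}, …, B_{t_n})` for `t_i ≤ s`. -/
  indep : ∀ (n : ℕ) (t : Fin n → ℝ≥0) (s h : ℝ≥0), (∀ i, t i ≤ s) →
    ∀ φ : (Fin n → EuclideanSpace ℝ (Fin d)) × EuclideanSpace ℝ (Fin d) → ℝ, IsBddLip φ →
      gExp 𝒬 (fun ω => φ (fun i => canon (t i) ω, canon (s + h) ω - canon s ω)) =
        gExp 𝒬 (fun ω => gExp 𝒬 (fun ω' =>
          φ (fun i => canon (t i) ω, canon (s + h) ω' - canon s ω')))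
  /-- `B_{s+h} - B_s` and `B_h` are identically distributed. -/
  stationary : ∀ (s h : ℝ≥0) (φ : EuclideanSpace ℝ (Fin d) → ℝ), IsBddLip φ →
    gExp 𝒬 (fun ω => φ (canon (s + h) ω - canon s ω)) = gExp 𝒬 (fun ω => φ (canon h ω))
  /-- `a X + b X'` has the law of `√(a² + b²) X` for `X = B_1` and an independent copy `X'`. -/
  normal : ∀ a b : ℝ, 0 ≤ a → 0 ≤ b → ∀ φ : EuclideanSpace ℝ (Fin d) → ℝ, IsBddLip φ →
    gExp 𝒬 (fun ω => gExp 𝒬 (fun ω' => φ (a • canon 1 ω + b • canon 1 ω'))) =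
      gExp 𝒬 (fun ω => φ (√(a ^ 2 + b ^ 2) • canon 1 ω))
  /-- `G(A) = (1/2) E((A B_1, B_1))` for symmetric `A`. -/
  generator : ∀ A : Matrix (Fin d) (Fin d) ℝ, A.IsSymm →
    MemLG 𝒬 (fun ω => ∑ i, ∑ j, A i j * canon 1 ω i * canon 1 ω j) ∧
      gFun S A = (1 / 2) * gExp 𝒬 (fun ω => ∑ i, ∑ j, A i j * canon 1 ω i * canon 1 ω j)

/-- The cube `[0, T]^m`, with the Euclidean distance. -/
def cube (T : ℝ) (m : ℕ) : Set (EuclideanSpace ℝ (Fin m)) := {t | ∀ i, t i ∈ Set.Icc 0 T}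

/-- `sup_{s ≠ t} |y(t) - y(s)| / |t - s|^α`, with values in `[0, ∞]`. -/
noncomputable def holderSeminorm {T : ℝ} {m p : ℕ} (α : ℝ)
    (y : C(cube T m, EuclideanSpace ℝ (Fin p))) : ℝ≥0∞ :=
  ⨆ (s : cube T m) (t : cube T m) (_ : s ≠ t), ENNReal.ofReal (‖y t - y s‖ / dist t s ^ α)

/-! ### The path space is Polish -/

/-! All estimates are made under a single measure `P` with constants independent of `P`, `λ` and
`ε`; taking suprema then costs nothing.

The Hölder bound is Kolmogorov's argument. Fix `β < κ / q` and let `gridSum` add the `q`-th powers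
of dyadic increments, level `n` weighted by `2 ^ (n β q)`. Level `n` has `O(2 ^ (n m))` neighbouring
pairs, each with moment `O(2 ^ (-n (m + κ)))`, so the expectation is dominated by a geometric series
of ratio `2 ^ (β q - κ)` (`exists_upperExp_gridSum_le`). Pathwise chaining
(`dist_le_of_dist_gridPoint_le`) bounds the `β`-Hölder constant by a multiple of the `q`-th root of
`gridSum`. Tightness follows from Markov's inequality and Arzelà–Ascoli.

For membership in `L^1_G`: off an open set of small capacity the paths share a Hölder constant, so
continuity in `ω` at a countable dense set of times becomes continuity in the sup norm
(`quasiContinuous_of_forall_eval`). Bounded quasi-continuous functionals are then approximated by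
Lipschitz cylinder functionals, using tightness of `𝒬`, Tietze and Stone–Weierstrass.

For the limit: paths with a common Hölder constant that are close at finitely many points are
uniformly close, and `Φ` is uniformly continuous around a compact set that carries the limits up to
small capacity. -/

theorem PathSpace.isClosedEmbedding_val (d : ℕ) :
    IsClosedEmbedding
      (Subtype.val : PathSpace d → C(ℝ≥0, EuclideanSpace ℝ (Fin d))) := by
  have h : IsClosed {ω : C(ℝ≥0, EuclideanSpace ℝ (Fin d)) | ω 0 = 0} :=
    isClosed_eq (continuous_eval_const 0) continuous_const
  exact h.isClosedEmbedding_subtypeVal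

/-- Needed for the direction of Prokhorov's theorem that derives tightness from compactness. -/
instance PathSpace.instPolishSpace (d : ℕ) : PolishSpace (PathSpace d) :=
  (PathSpace.isClosedEmbedding_val d).polishSpace

theorem continuous_canon {d : ℕ} (t : ℝ≥0) : Continuous (canon t : PathSpace d → _) :=
  (continuous_eval_const t).comp (PathSpace.isClosedEmbedding_val d).continuous

theorem exists_canon_ne {d : ℕ} {ω ω' : PathSpace d} (h : ω ≠ ω') :
    ∃ t, canon t ω ≠ canon t ω' := by
  by_contra! H
  exact h (Subtype.ext (ContinuousMap.ext H))

/-! ### Upper expectations and capacities -/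

section Capacity

variable {d : ℕ} {𝒬 : Set (ProbabilityMeasure (PathSpace d))}

theorem upperExp_le_iff {X : PathSpace d → ℝ≥0∞} {c : ℝ≥0∞} :
    upperExp 𝒬 X ≤ c ↔ ∀ P ∈ 𝒬, ∫⁻ ω, X ω ∂(P : Measure (PathSpace d)) ≤ c := by
  simp [upperExp]

theorem lintegral_le_upperExp {P : ProbabilityMeasure (PathSpace d)} (hP : P ∈ 𝒬)
    (X : PathSpace d → ℝ≥0∞) : ∫⁻ ω, X ω ∂(P : Measure (PathSpace d)) ≤ upperExp 𝒬 X :=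
  le_iSup₂_of_le P hP le_rfl

theorem capacity_le_iff {A : Set (PathSpace d)} {c : ℝ≥0∞} :
    capacity 𝒬 A ≤ c ↔ ∀ P ∈ 𝒬, (P : Measure (PathSpace d)) A ≤ c := by
  simp [capacity]

theorem measure_le_capacity {P : ProbabilityMeasure (PathSpace d)} (hP : P ∈ 𝒬)
    (A : Set (PathSpace d)) : (P : Measure (PathSpace d)) A ≤ capacity 𝒬 A :=
  le_iSup₂_of_le P hP le_rfl

theorem capacity_mono {A B : Set (PathSpace d)} (h : A ⊆ B) : capacity 𝒬 A ≤ capacity 𝒬 B :=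
  iSup₂_mono fun _ _ => measure_mono h

theorem capacity_union_le (A B : Set (PathSpace d)) :
    capacity 𝒬 (A ∪ B) ≤ capacity 𝒬 A + capacity 𝒬 B :=
  capacity_le_iff.2 fun _ hP => (measure_union_le A B).trans
    (add_le_add (measure_le_capacity hP A) (measure_le_capacity hP B))

theorem capacity_iUnion_le {ι : Type*} [Countable ι] (A : ι → Set (PathSpace d)) :
    capacity 𝒬 (⋃ i, A i) ≤ ∑' i, capacity 𝒬 (A i) :=
  capacity_le_iff.2 fun _ hP => (measure_iUnion_le A).trans
    (ENNReal.tsum_le_tsum fun i => measure_le_capacity hP (A i))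

theorem capacity_biUnion_finset_le {ι : Type*} (s : Finset ι) (A : ι → Set (PathSpace d)) :
    capacity 𝒬 (⋃ i ∈ s, A i) ≤ ∑ i ∈ s, capacity 𝒬 (A i) :=
  capacity_le_iff.2 fun _ hP => (measure_biUnion_finset_le s A).trans
    (Finset.sum_le_sum fun i _ => measure_le_capacity hP (A i))

/-- **Markov's inequality** for upper expectations. -/
theorem mul_capacity_ge_le_upperExp {X : PathSpace d → ℝ≥0∞} (hX : Measurable X) (c : ℝ≥0∞) :
    c * capacity 𝒬 {ω | c ≤ X ω} ≤ upperExp 𝒬 X := by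
  simp only [capacity, ENNReal.mul_iSup]
  exact iSup₂_le fun P hP =>
    (mul_meas_ge_le_lintegral₀ hX.aemeasurable c).trans (lintegral_le_upperExp hP X)

theorem upperExp_le_add_mul_capacity {X : PathSpace d → ℝ≥0∞} {A : Set (PathSpace d)}
    {a b : ℝ≥0∞} (ha : ∀ ω, ω ∉ A → X ω ≤ a) (hb : ∀ ω, X ω ≤ b) :
    upperExp 𝒬 X ≤ a + b * capacity 𝒬 A := by
  refine upperExp_le_iff.2 fun P hP => ?_
  set μ : Measure (PathSpace d) := (P : Measure (PathSpace d))
  -- `A` need not be measurable. Its measurable hull depends on `P` but has the same `P`-measure,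
  -- which is all the bound uses.
  have hm := measurableSet_toMeasurable μ A
  calc ∫⁻ ω, X ω ∂μ
      ≤ ∫⁻ ω, (a + (toMeasurable μ A).indicator (fun _ => b) ω) ∂μ := by
        refine lintegral_mono fun ω => ?_
        by_cases h : ω ∈ toMeasurable μ A
        · simpa [h] using (hb ω).trans le_add_self
        · simpa [h] using ha ω fun h' => h (subset_toMeasurable μ A h')
    _ = a + b * μ A := by
        rw [lintegral_add_left measurable_const, lintegral_indicator hm]
        simp [μ]
    _ ≤ a + b * capacity 𝒬 A := by gcongr; exact measure_le_capacity hP A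

/-- A compact family of probability measures is uniformly tight. -/
theorem exists_isCompact_capacity_compl_le (h𝒬 : IsCompact 𝒬) {δ : ℝ≥0∞} (hδ : 0 < δ) :
    ∃ K : Set (PathSpace d), IsCompact K ∧ capacity 𝒬 Kᶜ ≤ δ := by
  let _ := TopologicalSpace.upgradeIsCompletelyMetrizable (PathSpace d)
  have h : IsCompact (closure 𝒬) := h𝒬.closure
  obtain ⟨K, hK, hle⟩ := isTightMeasureSet_iff_exists_isCompact_measure_compl_le.1
    (isTightMeasureSet_of_isCompact_closure h) δ hδ
  exact ⟨K, hK, capacity_le_iff.2 fun P hP => hle _ ⟨P, hP, rfl⟩⟩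

theorem gExp_nonneg {X : PathSpace d → ℝ} (h : ∀ ω, 0 ≤ X ω) : 0 ≤ gExp 𝒬 X :=
  Real.iSup_nonneg fun _ => integral_nonneg h

theorem gExp_le_of_upperExp_le {X : PathSpace d → ℝ} (h : ∀ ω, 0 ≤ X ω) (hX : Measurable X)
    {c : ℝ} (hc : 0 ≤ c) (hle : upperExp 𝒬 (fun ω => ENNReal.ofReal (X ω)) ≤ ENNReal.ofReal c) :
    gExp 𝒬 X ≤ c := by
  -- The sign of `c` matters when `𝒬` is empty, where the real supremum is `0`.
  refine Real.iSup_le (fun P => ?_) hc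
  rw [integral_eq_lintegral_of_nonneg_ae (ae_of_all _ h) hX.aestronglyMeasurable]
  exact ENNReal.toReal_le_of_le_ofReal hc ((lintegral_le_upperExp P.2 _).trans hle)

end Capacity

/-! ### Lipschitz cylinder functionals -/

section Cylinder

theorem IsBddLip.comp {E F : Type*} [PseudoMetricSpace E] [PseudoMetricSpace F] {φ : F → ℝ}
    (hφ : IsBddLip φ) {f : E → F} {K : ℝ≥0} (hf : LipschitzWith K f) : IsBddLip (φ ∘ f) := by
  obtain ⟨⟨M, hM⟩, K', hK'⟩ := hφ
  exact ⟨⟨M, fun x => hM _⟩, K' * K, hK'.comp hf⟩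

theorem IsBddLip.add {E : Type*} [PseudoMetricSpace E] {φ ψ : E → ℝ}
    (hφ : IsBddLip φ) (hψ : IsBddLip ψ) : IsBddLip (fun x => φ x + ψ x) := by
  obtain ⟨⟨M, hM⟩, K, hK⟩ := hφ
  obtain ⟨⟨M', hM'⟩, K', hK'⟩ := hψ
  exact ⟨⟨M + M', fun x => (abs_add_le _ _).trans (add_le_add (hM x) (hM' x))⟩, K + K',
    hK.add hK'⟩

theorem IsBddLip.mul {E : Type*} [PseudoMetricSpace E] {φ ψ : E → ℝ}
    (hφ : IsBddLip φ) (hψ : IsBddLip ψ) : IsBddLip (fun x => φ x * ψ x) := by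
  obtain ⟨⟨M, hM⟩, K, hK⟩ := hφ
  obtain ⟨⟨M', hM'⟩, K', hK'⟩ := hψ
  refine ⟨⟨M * M', fun x => ?_⟩, M.toNNReal * K' + M'.toNNReal * K,
    LipschitzWith.of_dist_le_mul fun x y => ?_⟩
  · rw [abs_mul]
    exact mul_le_mul (hM x) (hM' x) (abs_nonneg _) ((abs_nonneg _).trans (hM x))
  · have h0 : 0 ≤ M := (abs_nonneg _).trans (hM x)
    have h0' : 0 ≤ M' := (abs_nonneg _).trans (hM' x)
    have h1 := hK.dist_le_mul x y
    have h2 := hK'.dist_le_mul x y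
    rw [Real.dist_eq] at h1 h2 ⊢
    have h3 : φ x * ψ x - φ y * ψ y = φ x * (ψ x - ψ y) + ψ y * (φ x - φ y) := by ring
    rw [h3]
    refine (abs_add_le _ _).trans ?_
    rw [abs_mul, abs_mul]
    push_cast
    rw [Real.coe_toNNReal _ h0, Real.coe_toNNReal _ h0', add_mul, mul_assoc, mul_assoc]
    exact add_le_add (mul_le_mul (hM x) h2 (abs_nonneg _) h0)
      (mul_le_mul (hM' y) h1 (abs_nonneg _) h0')

variable {d : ℕ}

theorem isLip_const (c : ℝ) : IsLip (fun _ : PathSpace d => c) :=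
  ⟨0, Fin.elim0, fun _ => c, ⟨⟨|c|, fun _ => le_rfl⟩, 0, LipschitzWith.const c⟩, rfl⟩

theorem IsLip.comp_lipschitz {X : PathSpace d → ℝ} (hX : IsLip X) {f : ℝ → ℝ} {K : ℝ≥0}
    (hf : LipschitzWith K f) : IsLip (fun ω => f (X ω)) := by
  obtain ⟨n, t, φ, ⟨⟨M, hM⟩, K', hK'⟩, rfl⟩ := hX
  refine ⟨n, t, f ∘ φ, ⟨⟨K * M + |f 0|, fun x => ?_⟩, K * K', hf.comp hK'⟩, rfl⟩
  have h := hf.dist_le_mul (φ x) 0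
  rw [Real.dist_eq, Real.dist_eq, sub_zero] at h
  have h1 : |f (φ x)| ≤ |f (φ x) - f 0| + |f 0| := by
    simpa using abs_add_le (f (φ x) - f 0) (f 0)
  have h2 : (K : ℝ) * |φ x| ≤ K * M := mul_le_mul_of_nonneg_left (hM x) K.2
  simp only [Function.comp_apply]
  linarith

/-- Concatenate the two lists of times; restriction to either block is 1-Lipschitz for the sup
metric. -/
theorem IsLip.exists_common {X Z : PathSpace d → ℝ} (hX : IsLip X) (hZ : IsLip Z) :
    ∃ (n : ℕ) (t : Fin n → ℝ≥0) (φ ψ : (Fin n → EuclideanSpace ℝ (Fin d)) → ℝ),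
      IsBddLip φ ∧ IsBddLip ψ ∧ X = (fun ω => φ (fun i => canon (t i) ω)) ∧
        Z = fun ω => ψ (fun i => canon (t i) ω) := by
  obtain ⟨n, t, φ, hφ, rfl⟩ := hX
  obtain ⟨n', t', ψ, hψ, rfl⟩ := hZ
  have h {k l : ℕ} (f : Fin k → Fin l) :
      LipschitzWith 1 (fun (x : Fin l → EuclideanSpace ℝ (Fin d)) i => x (f i)) :=
    LipschitzWith.of_dist_le_mul fun x y => by
      rw [NNReal.coe_one, one_mul]
      exact (dist_pi_le_iff dist_nonneg).2 fun i => dist_le_pi_dist x y (f i)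
  refine ⟨n + n', Fin.append t t', _, _, hφ.comp (h (Fin.castAdd n')), hψ.comp (h (Fin.natAdd n)),
    ?_, ?_⟩ <;> simp

theorem IsLip.add {X Z : PathSpace d → ℝ} (hX : IsLip X) (hZ : IsLip Z) :
    IsLip (fun ω => X ω + Z ω) := by
  obtain ⟨n, t, φ, ψ, hφ, hψ, rfl, rfl⟩ := hX.exists_common hZ
  exact ⟨n, t, _, hφ.add hψ, rfl⟩

theorem IsLip.mul {X Z : PathSpace d → ℝ} (hX : IsLip X) (hZ : IsLip Z) :
    IsLip (fun ω => X ω * Z ω) := by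
  obtain ⟨n, t, φ, ψ, hφ, hψ, rfl, rfl⟩ := hX.exists_common hZ
  exact ⟨n, t, _, hφ.mul hψ, rfl⟩

/-- The algebra of bounded Lipschitz cylinder functionals. -/
def lipSubalgebra (d : ℕ) : Subalgebra ℝ C(PathSpace d, ℝ) where
  carrier := {f | IsLip f}
  mul_mem' hf hg := hf.mul hg
  add_mem' hf hg := hf.add hg
  algebraMap_mem' c := isLip_const c

/-- The distance to `ω_t`, at a time `t` where the paths differ, separates them; truncating it at
`1` makes it bounded. -/
theorem lipSubalgebra_separatesPoints (d : ℕ) : (lipSubalgebra d).SeparatesPoints := by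
  intro ω ω' h
  obtain ⟨t, ht⟩ := exists_canon_ne h
  let f : C(PathSpace d, ℝ) :=
    ⟨fun ω₁ => min (dist (canon t ω₁) (canon t ω)) 1,
      ((continuous_canon t).dist continuous_const).min continuous_const⟩
  have hf : f ∈ lipSubalgebra d := by
    refine ⟨1, fun _ => t, fun x => min (dist (x 0) (canon t ω)) 1, ⟨⟨1, fun x => ?_⟩, 1, ?_⟩, rfl⟩
    · rw [abs_of_nonneg (le_min dist_nonneg zero_le_one)]
      exact min_le_right _ _
    · have h1 : LipschitzWith 1 fun x : Fin 1 → EuclideanSpace ℝ (Fin d) =>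
          dist (x 0) (canon t ω) := by
        have h2 := (LipschitzWith.dist_left (canon t ω)).comp
          (LipschitzWith.eval (α := fun _ : Fin 1 => EuclideanSpace ℝ (Fin d)) 0)
        rwa [mul_one] at h2
      exact h1.min_const 1
  refine ⟨f, ⟨f, hf, rfl⟩, ?_⟩
  have h1 : f ω = 0 := by simp [f]
  have h2 : 0 < f ω' := lt_min (dist_pos.2 ht.symm) one_pos
  rw [h1]
  exact h2.ne

end Cylinder

/-! ### Bounded quasi-continuous functionals belong to `L^1_G` -/

section QuasiContinuous

variable {d : ℕ} {𝒬 : Set (ProbabilityMeasure (PathSpace d))}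

/-- Tietze extends `X` from the closed set `Oᶜ` to all of `Ω`, and Stone–Weierstrass approximates
the extension on a compact `K` outside which the capacity is small. -/
theorem exists_isLip_upperExp_sub_le (h𝒬 : IsCompact 𝒬) {X : PathSpace d → ℝ}
    (hX : QuasiContinuous 𝒬 X) {M : ℝ} (hM : ∀ ω, |X ω| ≤ M) {η : ℝ} (hη : 0 < η) :
    ∃ Z, IsLip Z ∧ upperExp 𝒬 (fun ω => ENNReal.ofReal |Z ω - X ω|) ≤ ENNReal.ofReal η := by
  rcases isEmpty_or_nonempty (PathSpace d) with hemp | ⟨⟨ω₀⟩⟩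
  · refine ⟨fun _ => 0, isLip_const 0, upperExp_le_iff.2 fun P _ => ?_⟩
    simp [lintegral_of_isEmpty]
  have hM0 : 0 ≤ M := (abs_nonneg _).trans (hM ω₀)
  -- The error is at most `2 M` on `O ∪ Kᶜ`, of capacity at most `2 δ`; this contributes `4 M δ ≤ η
  -- / 2`.
  set δ : ℝ := η / (8 * (M + 1)) with hδ
  have hδ0 : 0 < δ := by positivity
  obtain ⟨O, hO, hOδ, hcont⟩ := hX (ENNReal.ofReal δ) (by simpa using hδ0)
  obtain ⟨K, hK, hKδ⟩ := exists_isCompact_capacity_compl_le h𝒬 (δ := ENNReal.ofReal δ)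
    (by simpa using hδ0)
  let f : (Oᶜ : Set (PathSpace d)) →ᵇ ℝ := BoundedContinuousFunction.ofNormedAddCommGroup
    (Oᶜ.domRestrict X) (continuousOn_iff_continuous_domRestrict.1 hcont) M fun x => hM x
  obtain ⟨g, hg, hgf⟩ := f.exists_extension_forall_mem_Icc_of_isClosedEmbedding
    (a := -M) (b := M) (fun x => abs_le.1 (hM x)) (by linarith)
    hO.isClosed_compl.isClosedEmbedding_subtypeVal
  obtain ⟨u, hu, hug⟩ :=
    ContinuousMap.exists_mem_subalgebra_near_continuous_of_isCompact_of_separatesPoints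
      (lipSubalgebra_separatesPoints d) g.toContinuousMap hK (half_pos hη)
  -- Off `K` nothing bounds `u` in terms of `M`. Clamping to `[-M, M]` repairs this, and being
  -- 1-Lipschitz and fixing the values of `X` it does not worsen the error on `K`.
  have hclamp : LipschitzWith 1 fun x : ℝ => max (-M) (min M x) :=
    (LipschitzWith.id.const_min M).const_max (-M)
  refine ⟨fun ω => max (-M) (min M (u ω)), IsLip.comp_lipschitz hu hclamp, ?_⟩
  refine (upperExp_le_add_mul_capacity (A := O ∪ Kᶜ) (a := ENNReal.ofReal (η / 2))
    (b := ENNReal.ofReal (2 * M)) (fun ω hω => ?_) fun ω => ?_).trans ?_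
  · simp only [mem_union, mem_compl_iff, not_or, not_not] at hω
    have h1 : g ω = X ω := congrFun hgf ⟨ω, hω.1⟩
    have h2 : max (-M) (min M (X ω)) = X ω := by
      rw [min_eq_right (abs_le.1 (hM ω)).2, max_eq_right (abs_le.1 (hM ω)).1]
    have h3 := hclamp.dist_le_mul (u ω) (X ω)
    have h4 := hug ω hω.2
    simp only [Real.dist_eq, NNReal.coe_one, one_mul, h2] at h3
    rw [Real.norm_eq_abs] at h4
    refine ENNReal.ofReal_le_ofReal (h3.trans ?_)
    rw [← h1]
    exact h4.le
  · refine ENNReal.ofReal_le_ofReal ((abs_sub _ _).trans ?_)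
    have h1 : |max (-M) (min M (u ω))| ≤ M :=
      abs_le.2 ⟨le_max_left _ _, max_le (by linarith) (min_le_left _ _)⟩
    linarith [hM ω]
  · calc ENNReal.ofReal (η / 2) + ENNReal.ofReal (2 * M) * capacity 𝒬 (O ∪ Kᶜ)
        ≤ ENNReal.ofReal (η / 2) + ENNReal.ofReal (2 * M) *
          (ENNReal.ofReal δ + ENNReal.ofReal δ) := by
          gcongr
          exact (capacity_union_le _ _).trans (add_le_add hOδ.le hKδ)
      _ = ENNReal.ofReal (η / 2 + 2 * M * (δ + δ)) := by
          rw [← ENNReal.ofReal_add hδ0.le hδ0.le, ← ENNReal.ofReal_mul (by positivity),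
            ← ENNReal.ofReal_add (by positivity) (by positivity)]
      _ ≤ ENNReal.ofReal η := by
          refine ENNReal.ofReal_le_ofReal ?_
          have h1 : (M + 1) * δ = η / 8 := by rw [hδ]; field_simp
          nlinarith

theorem QuasiContinuous.memLG (h𝒬 : IsCompact 𝒬) {X : PathSpace d → ℝ} (hm : Measurable X)
    (hX : QuasiContinuous 𝒬 X) {M : ℝ} (hM : ∀ ω, |X ω| ≤ M) : MemLG 𝒬 X := by
  choose Z hZ hle using fun n : ℕ =>
    exists_isLip_upperExp_sub_le h𝒬 hX hM (η := 1 / ((n : ℝ) + 1)) (by positivity)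
  refine ⟨hm, Z, hZ, tendsto_of_tendsto_of_tendsto_of_le_of_le tendsto_const_nhds ?_
    (fun _ => zero_le) hle⟩
  simpa using ENNReal.tendsto_ofReal tendsto_one_div_add_atTop_nhds_zero_nat

theorem QuasiContinuous.comp₂ {S S' R : Type*} [TopologicalSpace S] [TopologicalSpace S']
    [TopologicalSpace R] {X : PathSpace d → S} {Z : PathSpace d → S'}
    (hX : QuasiContinuous 𝒬 X) (hZ : QuasiContinuous 𝒬 Z) {f : S → S' → R}
    (hf : Continuous fun x : S × S' => f x.1 x.2) :
    QuasiContinuous 𝒬 (fun ω => f (X ω) (Z ω)) := by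
  intro δ hδ
  obtain ⟨O, hO, hOδ, hc⟩ := hX (δ / 2) (ENNReal.half_pos hδ.ne')
  obtain ⟨O', hO', hOδ', hc'⟩ := hZ (δ / 2) (ENNReal.half_pos hδ.ne')
  refine ⟨O ∪ O', hO.union hO', ?_, ?_⟩
  · refine (capacity_union_le _ _).trans_lt ?_
    rw [← ENNReal.add_halves δ]
    exact ENNReal.add_lt_add hOδ hOδ'
  · exact hf.comp_continuousOn
      ((hc.mono (by simp)).prodMk (hc'.mono (by simp)))

end QuasiContinuous

/-! ### Dyadic grids of the cube -/

section Grid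

variable {T : ℝ} {m : ℕ}

instance cube.instCompactSpace (T : ℝ) (m : ℕ) : CompactSpace (cube T m) := by
  rw [← isCompact_iff_compactSpace]
  have h : cube T m = (EuclideanSpace.equiv (Fin m) ℝ).toHomeomorph ⁻¹'
      (Set.univ.pi fun _ => Set.Icc (0 : ℝ) T) := by
    ext t
    simp only [cube, mem_preimage, mem_univ_pi]
    rfl
  rw [h, Homeomorph.isCompact_preimage]
  exact isCompact_univ_pi fun _ => isCompact_Icc

theorem cube.dist_le_of_forall_abs_sub_le {s t : cube T m} {δ : ℝ} (hδ : 0 ≤ δ)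
    (h : ∀ i, |s.1 i - t.1 i| ≤ δ) : dist s t ≤ √m * δ := by
  rw [Subtype.dist_eq, EuclideanSpace.dist_eq]
  have h1 : ∑ i, dist (s.1 i) (t.1 i) ^ 2 ≤ m * δ ^ 2 := by
    refine (Finset.sum_le_sum (g := fun _ => δ ^ 2) fun i _ => ?_).trans (by simp)
    exact pow_le_pow_left₀ dist_nonneg (h i) 2
  refine (Real.sqrt_le_sqrt h1).trans ?_
  rw [Real.sqrt_mul (Nat.cast_nonneg m), Real.sqrt_sq hδ]

theorem cube.abs_sub_le_dist (s t : cube T m) (i : Fin m) : |s.1 i - t.1 i| ≤ dist s t := by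
  rw [Subtype.dist_eq, dist_eq_norm]
  simpa using PiLp.norm_apply_le (s.1 - t.1) i

theorem cube.dist_le (hT : 0 ≤ T) (s t : cube T m) : dist s t ≤ √m * T :=
  cube.dist_le_of_forall_abs_sub_le hT fun i => by
    have h1 := s.2 i
    have h2 := t.2 i
    exact abs_le.2 ⟨by linarith [h1.1, h2.2], by linarith [h1.2, h2.1]⟩

/-- The point of the grid of mesh `T / 2 ^ n` with the given integer coordinates, truncated to the
cube. -/
noncomputable def gridPoint (hT : 0 ≤ T) (n : ℕ) (k : Fin m → ℕ) : cube T m :=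
  ⟨WithLp.toLp 2 fun i => T * ((min (k i) (2 ^ n) : ℕ) : ℝ) / 2 ^ n, fun i => by
    have h : ((min (k i) (2 ^ n) : ℕ) : ℝ) ≤ 2 ^ n := by exact_mod_cast min_le_right _ _
    refine ⟨by simp only; positivity, ?_⟩
    simp only
    rw [div_le_iff₀ (by positivity)]
    gcongr⟩

theorem gridPoint_apply (hT : 0 ≤ T) (n : ℕ) (k : Fin m → ℕ) (i : Fin m) :
    (gridPoint hT n k).1 i = T * ((min (k i) (2 ^ n) : ℕ) : ℝ) / 2 ^ n := rfl

/-- The grids are nested, so consecutive dyadic approximations of a point can be compared as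
neighbours in the finer grid. -/
theorem gridPoint_succ (hT : 0 ≤ T) (n : ℕ) (k : Fin m → ℕ) :
    gridPoint hT (n + 1) (fun i => 2 * k i) = gridPoint hT n k := by
  refine Subtype.ext (PiLp.ext fun i => ?_)
  rw [gridPoint_apply, gridPoint_apply, pow_succ', Nat.mul_min_mul_left, pow_succ']
  push_cast
  field_simp

theorem dist_gridPoint_le (hT : 0 ≤ T) (n : ℕ) {a b : Fin m → ℕ}
    (h : ∀ i, a i ≤ b i + 1 ∧ b i ≤ a i + 1) :
    dist (gridPoint hT n a) (gridPoint hT n b) ≤ √m * (T / 2 ^ n) := by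
  refine cube.dist_le_of_forall_abs_sub_le (by positivity) fun i => ?_
  rw [gridPoint_apply, gridPoint_apply, ← sub_div, ← mul_sub, abs_div, abs_mul, abs_of_nonneg hT,
    abs_of_pos (show (0 : ℝ) < 2 ^ n by positivity)]
  have h1 : |((min (a i) (2 ^ n) : ℕ) : ℝ) - ((min (b i) (2 ^ n) : ℕ) : ℝ)| ≤ 1 := by
    have h2 : min (a i) (2 ^ n) ≤ min (b i) (2 ^ n) + 1 := by have := h i; omega
    have h3 : min (b i) (2 ^ n) ≤ min (a i) (2 ^ n) + 1 := by have := h i; omega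
    rw [abs_le]
    constructor
    · have : ((min (b i) (2 ^ n) : ℕ) : ℝ) ≤ (min (a i) (2 ^ n) : ℕ) + 1 := by exact_mod_cast h3
      linarith
    · have : ((min (a i) (2 ^ n) : ℕ) : ℝ) ≤ (min (b i) (2 ^ n) : ℕ) + 1 := by exact_mod_cast h2
      linarith
  gcongr
  exact mul_le_of_le_one_right hT h1

/-- The integer coordinates of the lower left corner of the cell of mesh `T / 2 ^ n` containing
`t`. -/
noncomputable def gridIndex (n : ℕ) (t : cube T m) (i : Fin m) : ℕ := ⌊2 ^ n * t.1 i / T⌋₊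

theorem gridIndex_le (hT : 0 < T) (n : ℕ) (t : cube T m) (i : Fin m) :
    gridIndex n t i ≤ 2 ^ n := by
  refine Nat.floor_le_of_le ?_
  rw [div_le_iff₀ hT]
  push_cast
  exact mul_le_mul_of_nonneg_left (t.2 i).2 (by positivity)

theorem gridIndex_le_mul (hT : 0 < T) (n : ℕ) (t : cube T m) (i : Fin m) :
    (gridIndex n t i : ℝ) ≤ 2 ^ n * t.1 i / T :=
  Nat.floor_le (div_nonneg (mul_nonneg (by positivity) (t.2 i).1) hT.le)

theorem lt_gridIndex_add_one (n : ℕ) (t : cube T m) (i : Fin m) :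
    2 ^ n * t.1 i / T < gridIndex n t i + 1 := Nat.lt_floor_add_one _

theorem gridIndex_succ (hT : 0 < T) (n : ℕ) (t : cube T m) (i : Fin m) :
    2 * gridIndex n t i ≤ gridIndex (n + 1) t i ∧
      gridIndex (n + 1) t i ≤ 2 * gridIndex n t i + 1 := by
  have h1 := gridIndex_le_mul hT n t i
  have h2 := lt_gridIndex_add_one n t i
  have h3 : (2 : ℝ) ^ (n + 1) * t.1 i / T = 2 * (2 ^ n * t.1 i / T) := by rw [pow_succ']; ring
  constructor
  · refine Nat.le_floor ?_
    rw [h3]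
    push_cast
    linarith
  · refine Nat.lt_succ_iff.1 ((Nat.floor_lt' (by omega)).2 ?_)
    rw [h3]
    push_cast
    linarith

theorem gridIndex_le_of_abs_sub_le (hT : 0 < T) (n : ℕ) (s t : cube T m) (i : Fin m)
    (h : |s.1 i - t.1 i| ≤ T / 2 ^ n) : gridIndex n s i ≤ gridIndex n t i + 1 := by
  have h1 := gridIndex_le_mul hT n s i
  have h2 := lt_gridIndex_add_one n t i
  have h3 : 2 ^ n * s.1 i / T ≤ 2 ^ n * t.1 i / T + 1 := by
    have h4 : s.1 i ≤ t.1 i + T / 2 ^ n := by linarith [(abs_le.1 h).2]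
    calc 2 ^ n * s.1 i / T ≤ 2 ^ n * (t.1 i + T / 2 ^ n) / T := by gcongr
      _ = _ := by field_simp
  have h5 : (gridIndex n s i : ℝ) < gridIndex n t i + 1 + 1 := by linarith
  exact Nat.lt_succ_iff.1 (by exact_mod_cast h5)

theorem dist_gridPoint_gridIndex_le (hT : 0 < T) (n : ℕ) (t : cube T m) :
    dist (gridPoint hT.le n (gridIndex n t)) t ≤ √m * (T / 2 ^ n) := by
  refine cube.dist_le_of_forall_abs_sub_le (by positivity) fun i => ?_
  rw [gridPoint_apply, min_eq_left (gridIndex_le hT n t i)]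
  have h1 := gridIndex_le_mul hT n t i
  have h2 := lt_gridIndex_add_one n t i
  have h3 : T * (gridIndex n t i : ℝ) / 2 ^ n ≤ t.1 i := by
    rw [div_le_iff₀ (by positivity)]
    rw [le_div_iff₀ hT] at h1
    linarith
  have h4 : t.1 i ≤ T * (gridIndex n t i : ℝ) / 2 ^ n + T / 2 ^ n := by
    rw [← add_div, le_div_iff₀ (by positivity)]
    rw [div_lt_iff₀ hT] at h2
    linarith
  exact abs_le.2 ⟨by linarith, by linarith⟩

theorem tendsto_gridPoint_gridIndex (hT : 0 < T) (t : cube T m) :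
    Tendsto (fun n => gridPoint hT.le n (gridIndex n t)) atTop (𝓝 t) := by
  rw [tendsto_iff_dist_tendsto_zero]
  refine squeeze_zero (fun _ => dist_nonneg) (fun n => dist_gridPoint_gridIndex_le hT n t) ?_
  have h : Tendsto (fun n : ℕ => √m * (T * (1 / 2) ^ n)) atTop (𝓝 (√m * (T * 0))) :=
    ((tendsto_pow_atTop_nhds_zero_of_lt_one (by norm_num) (by norm_num)).const_mul _).const_mul _
  simpa [div_eq_mul_inv] using h

/-- **Chaining**: a continuous map on the cube whose increments between neighbours in the `n`-th
dyadic grid are at most `L 2 ^ (-n β)`, for all `n`, is `β`-Hölder continuous. -/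
theorem dist_le_of_dist_gridPoint_le (hT : 0 < T) {E : Type*} [PseudoMetricSpace E]
    {y : cube T m → E} (hy : Continuous y) {L β : ℝ} (hβ : 0 < β) (hL : 0 ≤ L)
    (h : ∀ n (a b : Fin m → ℕ), (∀ i, a i ≤ 2 ^ n) → (∀ i, a i ≤ b i + 1 ∧ b i ≤ a i + 1) →
      dist (y (gridPoint hT.le n a)) (y (gridPoint hT.le n b)) ≤ L * ((2 : ℝ) ^ (-β)) ^ n)
    (s t : cube T m) :
    dist (y s) (y t) ≤ L * (2 / (1 - (2 : ℝ) ^ (-β)) * (2 / T) ^ β) * dist s t ^ β := by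
  set r : ℝ := (2 : ℝ) ^ (-β) with hr
  have hr0 : 0 < r := by positivity
  have hr1 : r < 1 := Real.rpow_lt_one_of_one_lt_of_neg one_lt_two (by linarith)
  have hr1' : 0 < 1 - r := by linarith
  rcases eq_or_ne s t with rfl | hst
  · simp only [dist_self]
    positivity
  have hstep (u : cube T m) (n : ℕ) : dist (y (gridPoint hT.le n (gridIndex n u)))
      (y (gridPoint hT.le (n + 1) (gridIndex (n + 1) u))) ≤ L * r * r ^ n := by
    rw [← gridPoint_succ, mul_assoc, ← pow_succ']
    refine h (n + 1) _ _ (fun i => ?_) fun i => ?_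
    · have := gridIndex_le hT n u i
      rw [pow_succ']
      omega
    · have := gridIndex_succ hT n u i
      omega
  have hlim (u : cube T m) (n : ℕ) :
      dist (y (gridPoint hT.le n (gridIndex n u))) (y u) ≤ L * r * r ^ n / (1 - r) :=
    dist_le_of_le_geometric_of_tendsto r _ hr1 (hstep u)
      ((hy.tendsto u).comp (tendsto_gridPoint_gridIndex hT u)) n
  have hex : ∃ n : ℕ, ¬ ∀ i, |s.1 i - t.1 i| ≤ T / 2 ^ (n + 1) := by
    by_contra! H
    have h0 : Tendsto (fun n : ℕ => T / 2 ^ (n + 1)) atTop (𝓝 0) := by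
      have := (tendsto_pow_atTop_nhds_zero_of_lt_one (r := (1 / 2 : ℝ)) (by norm_num)
        (by norm_num)).comp (tendsto_add_atTop_nat 1) |>.const_mul T
      simpa [div_eq_mul_inv, Function.comp_def] using this
    refine hst (Subtype.ext (PiLp.ext fun i => ?_))
    have h1 := ge_of_tendsto' h0 fun n => H n i
    exact sub_eq_zero.1 (abs_nonpos_iff.1 h1)
  classical
  -- The scale of the pair: every coordinate differs by at most `T / 2 ^ n`, so the level-`n`
  -- corners are neighbours, while some coordinate differs by more than `T / 2 ^ (n + 1)`, so `2 ^
  -- (-n)` is controlled by `dist s t`. If `n = 0` the first property is just the side length of the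
  -- cube.
  set n := Nat.find hex with hn
  have hn1 := Nat.find_spec hex
  rw [← hn] at hn1
  push Not at hn1
  obtain ⟨i, hi⟩ := hn1
  have hn0 : ∀ i, |s.1 i - t.1 i| ≤ T / 2 ^ n := by
    rcases Nat.eq_zero_or_pos n with h0 | h0
    · intro i
      have h1 := s.2 i
      have h2 := t.2 i
      rw [h0, pow_zero, div_one]
      exact abs_le.2 ⟨by linarith [h1.1, h2.2], by linarith [h1.2, h2.1]⟩
    · have := Nat.find_min hex (m := n - 1) (by omega)
      rw [not_not, Nat.sub_add_cancel h0] at this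
      exact this
  have hmid : dist (y (gridPoint hT.le n (gridIndex n s))) (y (gridPoint hT.le n (gridIndex n t)))
      ≤ L * r ^ n :=
    h n _ _ (gridIndex_le hT n s) fun i =>
      ⟨gridIndex_le_of_abs_sub_le hT n s t i (hn0 i),
        gridIndex_le_of_abs_sub_le hT n t s i (by rw [abs_sub_comm]; exact hn0 i)⟩
  have hrn : r ^ n ≤ (2 / T) ^ β * dist s t ^ β := by
    have h1 : r ^ n = (1 / 2 ^ n : ℝ) ^ β := by
      rw [hr, ← Real.rpow_natCast, ← Real.rpow_mul zero_le_two, one_div, Real.inv_rpow (by positivity),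
        ← Real.rpow_natCast, ← Real.rpow_mul zero_le_two, ← Real.rpow_neg zero_le_two]
      congr 1
      ring
    rw [h1, ← Real.mul_rpow (by positivity) dist_nonneg]
    refine Real.rpow_le_rpow (by positivity) ?_ hβ.le
    have h2 : T / 2 ^ (n + 1) ≤ dist s t := hi.le.trans (cube.abs_sub_le_dist s t i)
    calc (1 / 2 ^ n : ℝ) = 2 / T * (T / 2 ^ (n + 1)) := by rw [pow_succ]; field_simp
      _ ≤ 2 / T * dist s t := by gcongr
  -- Two geometric tails, from `s` and `t` to their level-`n` corners, and one step between the
  -- corners.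
  have h4 : dist (y s) (y t) ≤ L * r * r ^ n / (1 - r) + L * r ^ n + L * r * r ^ n / (1 - r) := by
    refine (dist_triangle4 _ (y (gridPoint hT.le n (gridIndex n s)))
      (y (gridPoint hT.le n (gridIndex n t))) _).trans ?_
    gcongr
    · rw [dist_comm]
      exact hlim s n
    · exact hlim t n
  calc dist (y s) (y t) ≤ L * r * r ^ n / (1 - r) + L * r ^ n + L * r * r ^ n / (1 - r) := h4
    _ = L * r ^ n * ((1 + r) / (1 - r)) := by field_simp; ring
    _ ≤ L * r ^ n * (2 / (1 - r)) := by gcongr; linarith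
    _ ≤ L * ((2 / T) ^ β * dist s t ^ β) * (2 / (1 - r)) := by gcongr
    _ = _ := by ring

end Grid

/-! ### The Kolmogorov criterion -/

section Kolmogorov

variable {d m p : ℕ} {𝒬 : Set (ProbabilityMeasure (PathSpace d))} {T : ℝ}

/-- The sum over all dyadic levels of the `q`-th powers of the increments between neighbouring
grid points, level `n` having weight `2 ^ (n β q)`. -/
noncomputable def gridSum (hT : 0 ≤ T) (β q : ℝ)
    (y : C(cube T m, EuclideanSpace ℝ (Fin p))) : ℝ≥0∞ :=
  ∑' n : ℕ, ∑ k : (Fin m → Fin (2 ^ n + 1)) × (Fin m → Fin 3),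
    ENNReal.ofReal (((2 : ℝ) ^ (β * q)) ^ n) *
      ENNReal.ofReal (‖y (gridPoint hT n fun i => k.1 i) -
        y (gridPoint hT n fun i => k.1 i + k.2 i - 1)‖ ^ q)

theorem measurable_gridSum (hT : 0 ≤ T) (β q : ℝ) {Ω : Type*} [MeasurableSpace Ω]
    {Y : Ω → C(cube T m, EuclideanSpace ℝ (Fin p))} (hY : ∀ t, Measurable fun ω => Y ω t) :
    Measurable fun ω => gridSum hT β q (Y ω) := by
  refine Measurable.tsum fun n => Finset.measurable_fun_sum _ fun k _ => ?_
  exact (((hY _).sub (hY _)).norm.pow_const q).ennreal_ofReal.const_mul _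

theorem dist_gridPoint_le_of_gridSum (hT : 0 ≤ T) {β q : ℝ} (hq : 0 < q)
    {y : C(cube T m, EuclideanSpace ℝ (Fin p))} (hy : gridSum hT β q y ≠ ∞) (n : ℕ)
    (a b : Fin m → ℕ) (ha : ∀ i, a i ≤ 2 ^ n) (hab : ∀ i, a i ≤ b i + 1 ∧ b i ≤ a i + 1) :
    dist (y (gridPoint hT n a)) (y (gridPoint hT n b)) ≤
      (gridSum hT β q y).toReal ^ (1 / q) * ((2 : ℝ) ^ (-β)) ^ n := by
  -- The second component encodes `b - a + 1 ∈ {0, 1, 2}`; since `a ≤ b + 1`, no natural subtraction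
  -- is truncated.
  let k : (Fin m → Fin (2 ^ n + 1)) × (Fin m → Fin 3) :=
    (fun i => ⟨a i, Nat.lt_succ_iff.2 (ha i)⟩,
      fun i => ⟨b i + 1 - a i, by have := hab i; omega⟩)
  have hk1 : (fun i => (k.1 i : ℕ)) = a := rfl
  have hk2 : (fun i => (k.1 i : ℕ) + (k.2 i : ℕ) - 1) = b := by
    funext i
    have := hab i
    simp only [k]
    omega
  set x := dist (y (gridPoint hT n a)) (y (gridPoint hT n b)) with hx
  have hx0 : 0 ≤ x := dist_nonneg
  have h1 : ENNReal.ofReal (((2 : ℝ) ^ (β * q)) ^ n * x ^ q) ≤ gridSum hT β q y := by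
    refine le_trans ?_ (ENNReal.le_tsum n)
    refine le_trans ?_ (Finset.single_le_sum (fun _ _ => zero_le) (Finset.mem_univ k))
    rw [ENNReal.ofReal_mul (by positivity), hk1, hk2, hx, dist_eq_norm]
  have h2 : ((2 : ℝ) ^ (β * q)) ^ n * x ^ q ≤ (gridSum hT β q y).toReal :=
    (ENNReal.ofReal_le_iff_le_toReal hy).1 h1
  have h3 := Real.rpow_le_rpow (by positivity) h2 (z := 1 / q) (by positivity)
  have h4 : (((2 : ℝ) ^ (β * q)) ^ n * x ^ q) ^ (1 / q) = ((2 : ℝ) ^ β) ^ n * x := by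
    rw [Real.mul_rpow (by positivity) (by positivity), ← Real.rpow_mul hx0,
      mul_one_div_cancel hq.ne', Real.rpow_one, ← Real.rpow_natCast, ← Real.rpow_natCast,
      ← Real.rpow_mul zero_le_two, ← Real.rpow_mul zero_le_two, ← Real.rpow_mul zero_le_two]
    congr 2
    field_simp
  rw [h4] at h3
  rw [Real.rpow_neg zero_le_two, inv_pow, ← div_eq_mul_inv, le_div_iff₀ (by positivity), mul_comm]
  exact h3

/-- The Hölder constant furnished by chaining, in terms of the `q`-th root of `gridSum`. -/
noncomputable def chainingConst (T β : ℝ) : ℝ := 2 / (1 - (2 : ℝ) ^ (-β)) * (2 / T) ^ β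

theorem chainingConst_pos (hT : 0 < T) {β : ℝ} (hβ : 0 < β) : 0 < chainingConst T β := by
  have h : (2 : ℝ) ^ (-β) < 1 := Real.rpow_lt_one_of_one_lt_of_neg one_lt_two (by linarith)
  have h' : 0 < 1 - (2 : ℝ) ^ (-β) := by linarith
  unfold chainingConst
  positivity

theorem norm_sub_le_of_gridSum (hT : 0 < T) {β q : ℝ} (hβ : 0 < β) (hq : 0 < q)
    {y : C(cube T m, EuclideanSpace ℝ (Fin p))} (hy : gridSum hT.le β q y ≠ ∞) (s t : cube T m) :
    ‖y t - y s‖ ≤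
      (gridSum hT.le β q y).toReal ^ (1 / q) * chainingConst T β * dist t s ^ β := by
  rw [← dist_eq_norm]
  exact dist_le_of_dist_gridPoint_le hT y.continuous hβ (by positivity)
    (dist_gridPoint_le_of_gridSum hT.le hq hy) t s

/-- Lowering the exponent from `β` to `α` costs a power of the diameter, at most `√m * T`; the added
`1` keeps that base positive when `m = 0`. The right-hand side is measurable, so its expectation can
be computed term by term. -/
theorem holderSeminorm_rpow_le_gridSum (hT : 0 < T) {α β q : ℝ} (hα : α ≤ β) (hβ : 0 < β)
    (hq : 0 < q) (y : C(cube T m, EuclideanSpace ℝ (Fin p))) :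
    holderSeminorm α y ^ q ≤
      ENNReal.ofReal (((chainingConst T β + 1) * (√m * T + 1) ^ (β - α)) ^ q) *
        gridSum hT.le β q y := by
  have hc := chainingConst_pos hT hβ
  set c := (chainingConst T β + 1) * (√m * T + 1) ^ (β - α)
  have hc0 : 0 < c := by positivity
  rcases eq_or_ne (gridSum hT.le β q y) ∞ with hy | hy
  · rw [hy, ENNReal.mul_top]
    · exact le_top
    · simpa using Real.rpow_pos_of_pos hc0 q
  set A := (gridSum hT.le β q y).toReal with hA
  have hA0 : 0 ≤ A := ENNReal.toReal_nonneg
  have h1 : holderSeminorm α y ≤ ENNReal.ofReal (c * A ^ (1 / q)) := by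
    refine iSup_le fun s => iSup_le fun t => iSup_le fun hst => ENNReal.ofReal_le_ofReal ?_
    have hd : 0 < dist t s := dist_pos.2 hst.symm
    rw [div_le_iff₀ (by positivity)]
    have h2 : dist t s ^ β ≤ (√m * T + 1) ^ (β - α) * dist t s ^ α := by
      calc dist t s ^ β = dist t s ^ (β - α) * dist t s ^ α := by
            rw [← Real.rpow_add hd, sub_add_cancel]
        _ ≤ _ := by
            gcongr
            linarith [cube.dist_le hT.le t s]
    calc ‖y t - y s‖ ≤ A ^ (1 / q) * chainingConst T β * dist t s ^ β :=
          norm_sub_le_of_gridSum hT hβ hq hy s t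
      _ ≤ A ^ (1 / q) * (chainingConst T β + 1) * ((√m * T + 1) ^ (β - α) * dist t s ^ α) := by
          gcongr
          linarith
      _ = c * A ^ (1 / q) * dist t s ^ α := by simp only [c]; ring
  calc holderSeminorm α y ^ q ≤ ENNReal.ofReal (c * A ^ (1 / q)) ^ q := by gcongr
    _ = ENNReal.ofReal (c ^ q * A) := by
        rw [ENNReal.ofReal_rpow_of_nonneg (by positivity) hq.le,
          Real.mul_rpow hc0.le (by positivity), ← Real.rpow_mul hA0, one_div_mul_cancel hq.ne',
          Real.rpow_one]
    _ = _ := by rw [ENNReal.ofReal_mul (by positivity), hA, ENNReal.ofReal_toReal hy]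

/-- At level `n` there are `(2 ^ n + 1) ^ m * 3 ^ m ≤ 6 ^ m * 2 ^ (n m)` terms, and the exponent `m`
in the moment bound cancels this count, leaving `c * ρ ^ n`. `B` is chosen before `Y`, which gives
the uniformity. -/
theorem exists_upperExp_gridSum_le (hT : 0 ≤ T) {β q κ C : ℝ} (hβκ : β * q < κ)
    (hκ : 0 < κ) :
    ∃ B : ℝ≥0, ∀ Y : PathSpace d → C(cube T m, EuclideanSpace ℝ (Fin p)),
      (∀ t, Measurable fun ω => Y ω t) →
      (∀ s t, upperExp 𝒬 (fun ω => ENNReal.ofReal (‖Y ω t - Y ω s‖ ^ q)) ≤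
        ENNReal.ofReal (C * dist t s ^ ((m : ℝ) + κ))) →
      upperExp 𝒬 (fun ω => gridSum hT β q (Y ω)) ≤ B := by
  set ρ : ℝ := (2 : ℝ) ^ (β * q - κ) with hρ
  have hρ0 : 0 < ρ := by positivity
  have hρ1 : ρ < 1 := Real.rpow_lt_one_of_one_lt_of_neg one_lt_two (by linarith)
  set c : ℝ := 6 ^ m * (|C| * (√m * T) ^ (m + κ)) with hc
  have hc0 : 0 ≤ c := by positivity
  have hsum : Summable fun n : ℕ => c * ρ ^ n :=
    (summable_geometric_of_lt_one hρ0.le hρ1).mul_left c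
  refine ⟨(∑' n : ℕ, c * ρ ^ n).toNNReal, fun Y hY hmom => upperExp_le_iff.2 fun P hP => ?_⟩
  have hm (s t : cube T m) : Measurable fun ω => ENNReal.ofReal (‖Y ω s - Y ω t‖ ^ q) :=
    (((hY s).sub (hY t)).norm.pow_const q).ennreal_ofReal
  have hlevel (n : ℕ) (a b : Fin m → ℕ) (hab : ∀ i, a i ≤ b i + 1 ∧ b i ≤ a i + 1) :
      ∫⁻ ω, ENNReal.ofReal (((2 : ℝ) ^ (β * q)) ^ n) *
        ENNReal.ofReal (‖Y ω (gridPoint hT n a) - Y ω (gridPoint hT n b)‖ ^ q)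
          ∂(P : Measure (PathSpace d)) ≤
      ENNReal.ofReal (((2 : ℝ) ^ (β * q)) ^ n * (|C| * (√m * (T / 2 ^ n)) ^ (m + κ))) := by
    rw [lintegral_const_mul _ (hm _ _), ENNReal.ofReal_mul (by positivity)]
    gcongr
    refine (lintegral_le_upperExp hP _).trans ((hmom _ _).trans (ENNReal.ofReal_le_ofReal ?_))
    refine mul_le_mul (le_abs_self C) ?_ (by positivity) (abs_nonneg C)
    exact Real.rpow_le_rpow dist_nonneg (dist_gridPoint_le hT n hab) (by positivity)
  have hterm (n : ℕ) : (((2 ^ n + 1) ^ m * 3 ^ m : ℕ) : ℝ) *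
      (((2 : ℝ) ^ (β * q)) ^ n * (|C| * (√m * (T / 2 ^ n)) ^ (m + κ))) ≤ c * ρ ^ n := by
    have h1 : (((2 ^ n + 1) ^ m * 3 ^ m : ℕ) : ℝ) ≤ 6 ^ m * ((2 : ℝ) ^ n) ^ m := by
      have h2 : (1 : ℝ) ≤ 2 ^ n := one_le_pow₀ one_le_two
      push_cast
      calc ((2 : ℝ) ^ n + 1) ^ m * 3 ^ m ≤ (2 * 2 ^ n) ^ m * 3 ^ m := by gcongr; linarith
        _ = 6 ^ m * ((2 : ℝ) ^ n) ^ m := by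
          rw [show (6 : ℝ) = 2 * 3 by norm_num, mul_pow, mul_pow]; ring
    have h3 : (√m * (T / 2 ^ n)) ^ ((m : ℝ) + κ) =
        (√m * T) ^ ((m : ℝ) + κ) * ((2 : ℝ) ^ n) ^ (-((m : ℝ) + κ)) := by
      rw [← mul_div_assoc, Real.div_rpow (by positivity) (by positivity),
        Real.rpow_neg (by positivity), div_eq_mul_inv]
    have h4 : ((2 : ℝ) ^ n) ^ m * (((2 : ℝ) ^ (β * q)) ^ n * ((2 : ℝ) ^ n) ^ (-((m : ℝ) + κ)))
        = ρ ^ n := by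
      rw [hρ]
      simp only [← Real.rpow_natCast, ← Real.rpow_mul zero_le_two, ← Real.rpow_add zero_lt_two]
      congr 1
      ring
    calc _ ≤ 6 ^ m * ((2 : ℝ) ^ n) ^ m *
          (((2 : ℝ) ^ (β * q)) ^ n * (|C| * (√m * (T / 2 ^ n)) ^ (m + κ))) := by gcongr
      _ = c * (((2 : ℝ) ^ n) ^ m *
          (((2 : ℝ) ^ (β * q)) ^ n * ((2 : ℝ) ^ n) ^ (-((m : ℝ) + κ)))) := by
          rw [h3, hc]; ring
      _ = c * ρ ^ n := by rw [h4]
  have hmeas (n : ℕ) (k : (Fin m → Fin (2 ^ n + 1)) × (Fin m → Fin 3)) : Measurable fun ω =>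
      ENNReal.ofReal (((2 : ℝ) ^ (β * q)) ^ n) *
        ENNReal.ofReal (‖Y ω (gridPoint hT n fun i => k.1 i) -
          Y ω (gridPoint hT n fun i => k.1 i + k.2 i - 1)‖ ^ q) :=
    (hm _ _).const_mul _
  unfold gridSum
  rw [lintegral_tsum fun n => (Finset.measurable_fun_sum _ fun k _ => hmeas n k).aemeasurable]
  calc _ ≤ ∑' n : ℕ, ENNReal.ofReal (c * ρ ^ n) := by
        refine ENNReal.tsum_le_tsum fun n => ?_
        rw [lintegral_finsetSum _ fun k _ => hmeas n k]
        refine (Finset.sum_le_sum fun k _ => hlevel n _ _ fun i => ?_).trans ?_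
        -- When `k.1 i` and `k.2 i` both vanish, truncated subtraction returns `0`, still a
        -- neighbour.
        · have := (k.2 i).2
          omega
        · rw [Finset.sum_const, nsmul_eq_mul, ← ENNReal.ofReal_natCast,
            ← ENNReal.ofReal_mul (by positivity)]
          refine ENNReal.ofReal_le_ofReal ((le_of_eq ?_).trans (hterm n))
          simp
    _ = _ := (ENNReal.ofReal_tsum_of_nonneg (fun n => by positivity) hsum).symm

/-- Uniform bound in capacity for the `β`-Hölder constants. -/
theorem exists_capacity_not_holder_le (hT : 0 < T) {ι : Type*}
    {Y : ι → PathSpace d → C(cube T m, EuclideanSpace ℝ (Fin p))}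
    (hY : ∀ l t, Measurable fun ω => Y l ω t) {β q κ C : ℝ} (hβ : 0 < β) (hq : 0 < q)
    (hβκ : β * q < κ)
    (hmom : ∀ l s t, upperExp 𝒬 (fun ω => ENNReal.ofReal (‖Y l ω t - Y l ω s‖ ^ q)) ≤
        ENNReal.ofReal (C * dist t s ^ ((m : ℝ) + κ))) {δ : ℝ≥0∞} (hδ : 0 < δ) :
    ∃ R : ℝ, 0 ≤ R ∧ ∀ l,
      capacity 𝒬 {ω | ¬ ∀ s t, ‖Y l ω t - Y l ω s‖ ≤ R * dist t s ^ β} ≤ δ := by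
  obtain ⟨B, hB⟩ := exists_upperExp_gridSum_le (d := d) (p := p) (m := m) (𝒬 := 𝒬) (C := C)
    hT.le hβκ ((mul_pos hβ hq).trans hβκ)
  -- With `N * δ > B`, Markov's inequality gives `{N ≤ gridSum}` capacity at most `δ`; off this set
  -- the Hölder constant is at most `N ^ (1 / q) * chainingConst T β`.
  obtain ⟨N, hN⟩ := ENNReal.exists_nat_mul_gt hδ.ne' (ENNReal.coe_ne_top (r := B))
  have hc := chainingConst_pos hT hβ
  refine ⟨(N : ℝ) ^ (1 / q) * chainingConst T β, by positivity, fun l => ?_⟩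
  have hsub : {ω | ¬ ∀ s t, ‖Y l ω t - Y l ω s‖ ≤
      (N : ℝ) ^ (1 / q) * chainingConst T β * dist t s ^ β} ⊆
      {ω | (N : ℝ≥0∞) ≤ gridSum hT.le β q (Y l ω)} := by
    intro ω hω
    by_contra h
    simp only [mem_ofPred_eq, not_le] at h
    refine hω fun s t => (norm_sub_le_of_gridSum hT hβ hq h.ne_top s t).trans ?_
    gcongr
    simpa using ENNReal.toReal_mono (ENNReal.natCast_ne_top N) h.le
  refine (capacity_mono hsub).trans ?_
  by_contra! h
  have h1 := (mul_capacity_ge_le_upperExp (𝒬 := 𝒬) (measurable_gridSum hT.le β q (hY l))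
    (N : ℝ≥0∞)).trans (hB (Y l) (hY l) (hmom l))
  have h2 : (N : ℝ≥0∞) * δ ≤ B := le_trans (by gcongr) h1
  exact absurd hN h2.not_gt

end Kolmogorov

/-! ### Hölder balls in the space of continuous functions -/

section HolderBall

variable {m p : ℕ} {T : ℝ}

theorem tendsto_mul_rpow_nhds_zero (R : ℝ) {β : ℝ} (hβ : 0 < β) :
    Tendsto (fun x : ℝ => R * x ^ β) (𝓝 0) (𝓝 0) := by
  have h := ((Real.continuousAt_rpow_const 0 β (Or.inr hβ.le)).tendsto).const_mul R
  rwa [Real.zero_rpow hβ.ne', mul_zero] at h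

theorem isCompact_holderBall (t₀ : cube T m) (r R : ℝ) {β : ℝ} (hβ : 0 < β) :
    IsCompact {y : C(cube T m, EuclideanSpace ℝ (Fin p)) |
      ‖y t₀‖ ≤ r ∧ ∀ s t, ‖y t - y s‖ ≤ R * dist t s ^ β} := by
  have hlim := tendsto_mul_rpow_nhds_zero R hβ
  -- The Hölder bound forces continuity, so the image in the product space is cut out by the same
  -- inequalities and is therefore closed there.
  have himage : ContinuousMap.toFun '' {y : C(cube T m, EuclideanSpace ℝ (Fin p)) |
      ‖y t₀‖ ≤ r ∧ ∀ s t, ‖y t - y s‖ ≤ R * dist t s ^ β} =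
      {f | ‖f t₀‖ ≤ r ∧ ∀ s t, ‖f t - f s‖ ≤ R * dist t s ^ β} := by
    ext f
    refine ⟨?_, fun hf => ?_⟩
    · rintro ⟨y, hy, rfl⟩
      exact hy
    · have hc : Continuous f := (Metric.equicontinuous_of_continuity_modulus _ hlim
        (fun _ : Unit => f) fun s t _ => by rw [dist_eq_norm]; exact hf.2 t s).continuous ()
      exact ⟨⟨f, hc⟩, hf, rfl⟩
  refine ArzelaAscoli.isCompact_of_equicontinuous _ ?_ ?_
  · rw [himage]
    refine (isCompact_univ_pi fun t : cube T m =>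
      isCompact_closedBall (0 : EuclideanSpace ℝ (Fin p)) (r + R * dist t t₀ ^ β)).of_isClosed_subset
        ?_ fun f hf => ?_
    · have h : {f : cube T m → EuclideanSpace ℝ (Fin p) |
          ‖f t₀‖ ≤ r ∧ ∀ s t, ‖f t - f s‖ ≤ R * dist t s ^ β} =
          {f | ‖f t₀‖ ≤ r} ∩ ⋂ s, ⋂ t, {f | ‖f t - f s‖ ≤ R * dist t s ^ β} := by
        ext f
        simp
      rw [h]
      refine (isClosed_le (continuous_apply t₀).norm continuous_const).inter ?_
      exact isClosed_iInter fun s => isClosed_iInter fun t =>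
        isClosed_le ((continuous_apply t).sub (continuous_apply s)).norm continuous_const
    · refine mem_univ_pi.2 fun t => mem_closedBall_zero_iff.2 ?_
      calc ‖f t‖ = ‖f t₀ + (f t - f t₀)‖ := by rw [add_sub_cancel]
        _ ≤ ‖f t₀‖ + ‖f t - f t₀‖ := norm_add_le _ _
        _ ≤ _ := add_le_add hf.1 (hf.2 t₀ t)
  · refine Metric.equicontinuous_of_continuity_modulus _ hlim _ fun s t y => ?_
    rw [dist_eq_norm]
    exact y.2.2 t s

/-- Functions in a Hölder ball that are close on a suitable finite set are uniformly close. -/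
theorem exists_finset_dist_lt {D : Set (cube T m)} (hD : Dense D) (R : ℝ) {β r : ℝ} (hβ : 0 < β)
    (hr : 0 < r) :
    ∃ F : Finset D, ∀ y z : C(cube T m, EuclideanSpace ℝ (Fin p)),
      (∀ s t, ‖y t - y s‖ ≤ R * dist t s ^ β) → (∀ s t, ‖z t - z s‖ ≤ R * dist t s ^ β) →
      (∀ t ∈ F, ‖y t - z t‖ < r / 4) → dist y z < r := by
  -- At scale `ρ` each function oscillates by less than `r / 4`; with the error at a nearby point of
  -- the net the total stays below `3 (r / 4) < r`.
  obtain ⟨ρ, hρ, hR⟩ := Metric.eventually_nhds_iff.1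
    ((tendsto_mul_rpow_nhds_zero R hβ).eventually (gt_mem_nhds (show 0 < r / 4 by positivity)))
  obtain ⟨F, hF⟩ := isCompact_univ.elim_finite_subcover (fun t : D => Metric.ball (t : cube T m) ρ)
    (fun _ => Metric.isOpen_ball) fun t _ => by
      obtain ⟨u, hu, htu⟩ := hD.exists_dist_lt t hρ
      exact mem_iUnion.2 ⟨⟨u, hu⟩, htu⟩
  refine ⟨F, fun y z hy hz h => lt_of_le_of_lt ((ContinuousMap.dist_le
    (show 0 ≤ 3 * (r / 4) by positivity)).2 fun t => ?_) (show 3 * (r / 4) < r by linarith)⟩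
  obtain ⟨u, hu, htu⟩ := mem_iUnion₂.1 (hF (mem_univ t))
  have h0 : R * dist t u ^ β < r / 4 := hR (by simpa using htu)
  have h1 := hy u t
  have h2 := hz u t
  have h3 := h u hu
  rw [← dist_eq_norm] at h1 h2 h3
  have h4 := dist_triangle4 (y t) (y u) (z u) (z t)
  rw [dist_comm (z u)] at h4
  linarith

end HolderBall

/-! ### Random fields as random continuous functions -/

section RandomField

variable {m p : ℕ} {T : ℝ}

/-- A closed sup-norm ball is a countable intersection of conditions at a dense set of times, and by
separability every open set is a countable union of such balls. -/
theorem measurableSet_preimage_of_isOpen {Ω : Type*} [MeasurableSpace Ω]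
    {Y : Ω → C(cube T m, EuclideanSpace ℝ (Fin p))} (hY : ∀ t, Measurable fun ω => Y ω t)
    {U : Set C(cube T m, EuclideanSpace ℝ (Fin p))} (hU : IsOpen U) : MeasurableSet (Y ⁻¹' U) := by
  have hball (x : C(cube T m, EuclideanSpace ℝ (Fin p))) (r : ℝ) (hr : 0 < r) :
      MeasurableSet (Y ⁻¹' Metric.closedBall x r) := by
    obtain ⟨D, hDc, hD⟩ := TopologicalSpace.exists_countable_dense (cube T m)
    have h : Y ⁻¹' Metric.closedBall x r = ⋂ t ∈ D, {ω | dist (Y ω t) (x t) ≤ r} := by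
      ext ω
      simp only [mem_preimage, Metric.mem_closedBall, ContinuousMap.dist_le hr.le, mem_iInter,
        mem_ofPred_eq]
      refine ⟨fun h t _ => h t, fun h t => ?_⟩
      exact hD.induction (P := fun t => dist (Y ω t) (x t) ≤ r) h
        (isClosed_le ((Y ω).continuous.dist x.continuous) continuous_const) t
    rw [h]
    exact MeasurableSet.biInter hDc fun t _ =>
      measurableSet_le ((hY t).dist measurable_const) measurable_const
  choose! r hr hrU using fun x (hx : x ∈ U) =>
    Metric.nhds_basis_closedBall.mem_iff.1 (hU.mem_nhds hx)
  obtain ⟨S, hS, hSU⟩ := TopologicalSpace.isOpen_iUnion_countable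
    (fun x : U => Metric.ball (x : C(cube T m, EuclideanSpace ℝ (Fin p))) (r x))
    fun _ => Metric.isOpen_ball
  have h : U = ⋃ x ∈ S, Metric.closedBall (x : C(cube T m, EuclideanSpace ℝ (Fin p))) (r x) := by
    refine Subset.antisymm (fun x hx => ?_) (iUnion₂_subset fun x _ => hrU x x.2)
    have h1 : x ∈ ⋃ x : U, Metric.ball (x : C(cube T m, EuclideanSpace ℝ (Fin p))) (r x) :=
      mem_iUnion.2 ⟨⟨x, hx⟩, Metric.mem_ball_self (hr x hx)⟩
    rw [← hSU] at h1
    exact iUnion₂_mono (fun x _ => Metric.ball_subset_closedBall) h1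
  rw [h, preimage_iUnion₂]
  exact MeasurableSet.biUnion hS fun x _ => hball x _ (hr x x.2)

theorem measurable_comp_continuous {Ω : Type*} [MeasurableSpace Ω]
    {Y : Ω → C(cube T m, EuclideanSpace ℝ (Fin p))} (hY : ∀ t, Measurable fun ω => Y ω t)
    {Φ : C(cube T m, EuclideanSpace ℝ (Fin p)) → ℝ} (hΦ : Continuous Φ) :
    Measurable fun ω => Φ (Y ω) :=
  measurable_of_isOpen fun _ hU => measurableSet_preimage_of_isOpen hY (hU.preimage hΦ)

variable {d : ℕ} {𝒬 : Set (ProbabilityMeasure (PathSpace d))}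

/-- A pointwise quasi-continuous random field whose Hölder constants are finite, uniformly in
capacity, is quasi-continuous as a random element of the space of continuous functions. -/
theorem quasiContinuous_of_forall_eval
    {Y : PathSpace d → C(cube T m, EuclideanSpace ℝ (Fin p))}
    (hqc : ∀ t, QuasiContinuous 𝒬 fun ω => Y ω t) {β : ℝ} (hβ : 0 < β)
    (hY : ∀ δ : ℝ≥0∞, 0 < δ → ∃ R : ℝ, 0 ≤ R ∧
      capacity 𝒬 {ω | ¬ ∀ s t, ‖Y ω t - Y ω s‖ ≤ R * dist t s ^ β} ≤ δ) :
    QuasiContinuous 𝒬 Y := by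
  intro δ hδ
  obtain ⟨δ', hδ', hδδ⟩ := exists_between hδ
  obtain ⟨R, -, hRcap⟩ := hY (δ' / 2) (ENNReal.half_pos hδ'.ne')
  obtain ⟨D, hDc, hD⟩ := TopologicalSpace.exists_countable_dense (cube T m)
  have : Countable D := hDc.to_subtype
  obtain ⟨e, he, hesum⟩ := ENNReal.exists_pos_sum_of_countable' (ENNReal.half_pos hδ'.ne').ne' D
  choose O hO hOe hOc using fun t : D => hqc t (e t) (he t)
  set O' := ⋃ t, O t with hO'
  have hO'open : IsOpen O' := isOpen_iUnion hO
  set V := {ω | ∃ s t : D, R * dist (t : cube T m) s ^ β < ‖Y ω t - Y ω s‖} with hV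
  have hcont (t : D) : ContinuousOn (fun ω => Y ω t) O'ᶜ :=
    (hOc t).mono (compl_subset_compl.2 (subset_iUnion O t))
  -- `V` alone need not be open, as the evaluations are continuous only off `O'`; relative to the
  -- closed set `O'ᶜ` its defining conditions are open. Using only times in the countable set `D`
  -- lets `O'` have small capacity.
  have hopen : IsOpen (O' ∪ V) := by
    have h : O' ∪ V = O' ∪ ⋃ (s : D) (t : D),
        (O' ∪ {ω | R * dist (t : cube T m) s ^ β < ‖Y ω t - Y ω s‖}) := by
      ext ω
      simp only [hV, mem_union, mem_iUnion, mem_ofPred_eq]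
      constructor
      · rintro (h | ⟨s, t, h⟩)
        · exact Or.inl h
        · exact Or.inr ⟨s, t, Or.inr h⟩
      · rintro (h | ⟨s, t, h | h⟩)
        · exact Or.inl h
        · exact Or.inl h
        · exact Or.inr ⟨s, t, h⟩
    rw [h]
    refine hO'open.union (isOpen_iUnion fun s => isOpen_iUnion fun t => ?_)
    rw [← isClosed_compl_iff, compl_union]
    have := ((hcont t).sub (hcont s)).norm.preimage_isClosed_of_isClosed hO'open.isClosed_compl
      (isClosed_Iic (a := R * dist (t : cube T m) s ^ β))
    convert this using 2
    ext ω
    simp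
  have hVsub : V ⊆ {ω | ¬ ∀ s t, ‖Y ω t - Y ω s‖ ≤ R * dist t s ^ β} := by
    rintro ω ⟨s, t, h⟩ H
    exact absurd (H s t) h.not_ge
  have hhol (ω : PathSpace d) (hω : ω ∈ (O' ∪ V)ᶜ) (s t : cube T m) :
      ‖Y ω t - Y ω s‖ ≤ R * dist t s ^ β := by
    have hc : IsClosed {x : cube T m × cube T m | ‖Y ω x.2 - Y ω x.1‖ ≤ R * dist x.2 x.1 ^ β} := by
      refine isClosed_le (by fun_prop) (continuous_const.mul ?_)
      exact (continuous_snd.dist continuous_fst).rpow_const fun _ => Or.inr hβ.le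
    refine (hD.prod hD).induction (P := fun x : cube T m × cube T m =>
      ‖Y ω x.2 - Y ω x.1‖ ≤ R * dist x.2 x.1 ^ β) (fun x hx => ?_) hc (s, t)
    by_contra h
    exact hω (Or.inr ⟨⟨x.1, hx.1⟩, ⟨x.2, hx.2⟩, not_le.1 h⟩)
  refine ⟨O' ∪ V, hopen, ?_, fun ω₀ hω₀ => ?_⟩
  · refine lt_of_le_of_lt ?_ hδδ
    calc capacity 𝒬 (O' ∪ V) ≤ capacity 𝒬 O' + capacity 𝒬 V := capacity_union_le _ _
      _ ≤ δ' / 2 + δ' / 2 := by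
        refine add_le_add ?_ ((capacity_mono hVsub).trans hRcap)
        exact (capacity_iUnion_le O).trans
          ((ENNReal.tsum_le_tsum fun t => (hOe t).le).trans hesum.le)
      _ = δ' := ENNReal.add_halves δ'
  · refine Metric.tendsto_nhds.2 fun r hr => ?_
    obtain ⟨F, hF⟩ := exists_finset_dist_lt (p := p) hD R hβ hr
    have hev : ∀ᶠ ω in 𝓝[(O' ∪ V)ᶜ] ω₀, ∀ t ∈ F, ‖Y ω t - Y ω₀ t‖ < r / 4 := by
      rw [Filter.eventually_all_finset]
      intro t _
      have h1 := Metric.tendsto_nhds.1 (((hcont t).mono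
        (compl_subset_compl.2 subset_union_left)) ω₀ hω₀) (r / 4) (by positivity)
      simpa only [dist_eq_norm] using h1
    filter_upwards [hev, self_mem_nhdsWithin] with ω h1 h2
    exact hF _ _ (hhol ω h2) (hhol ω₀ hω₀) h1

theorem exists_isCompact_capacity_notMem_le {ι : Type*}
    {Y : ι → PathSpace d → C(cube T m, EuclideanSpace ℝ (Fin p))} {β : ℝ} (hβ : 0 < β)
    (hY : ∀ δ : ℝ≥0∞, 0 < δ → ∃ R : ℝ, 0 ≤ R ∧ ∀ l,
      capacity 𝒬 {ω | ¬ ∀ s t, ‖Y l ω t - Y l ω s‖ ≤ R * dist t s ^ β} ≤ δ)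
    {t₀ : cube T m}
    (ht₀ : ∀ δ : ℝ≥0∞, 0 < δ → ∃ R : ℝ, ∀ l, capacity 𝒬 {ω | R < ‖Y l ω t₀‖} ≤ δ)
    {δ : ℝ≥0∞} (hδ : 0 < δ) :
    ∃ K : Set C(cube T m, EuclideanSpace ℝ (Fin p)), IsCompact K ∧
      ∀ l, capacity 𝒬 {ω | Y l ω ∉ K} ≤ δ := by
  obtain ⟨R, -, hR⟩ := hY (δ / 2) (ENNReal.half_pos hδ.ne')
  obtain ⟨r, hr⟩ := ht₀ (δ / 2) (ENNReal.half_pos hδ.ne')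
  refine ⟨_, isCompact_holderBall t₀ r R hβ, fun l => ?_⟩
  calc _ ≤ capacity 𝒬 ({ω | r < ‖Y l ω t₀‖} ∪
        {ω | ¬ ∀ s t, ‖Y l ω t - Y l ω s‖ ≤ R * dist t s ^ β}) := by
        refine capacity_mono fun ω hω => ?_
        simp only [mem_ofPred_eq, not_and_or, not_le] at hω
        exact hω
    _ ≤ δ / 2 + δ / 2 := (capacity_union_le _ _).trans (add_le_add (hr l) (hR l))
    _ = δ := ENNReal.add_halves δ

/-- Convergence in capacity at every point, together with uniform Hölder bounds and tightness of
the limits, implies convergence of bounded continuous functionals, uniformly in the parameter. -/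
theorem tendsto_iSup_gExp_abs_sub {Λ ι : Type*} {ℱ : Filter ι}
    {Y : Λ → ι → PathSpace d → C(cube T m, EuclideanSpace ℝ (Fin p))}
    {Z : Λ → PathSpace d → C(cube T m, EuclideanSpace ℝ (Fin p))}
    (hYm : ∀ l ε t, Measurable fun ω => Y l ε ω t) (hZm : ∀ l t, Measurable fun ω => Z l ω t)
    {β : ℝ} (hβ : 0 < β)
    (hY : ∀ δ : ℝ≥0∞, 0 < δ → ∃ R : ℝ, 0 ≤ R ∧ ∀ l,
      (∀ ε, capacity 𝒬 {ω | ¬ ∀ s t, ‖Y l ε ω t - Y l ε ω s‖ ≤ R * dist t s ^ β} ≤ δ) ∧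
      capacity 𝒬 {ω | ¬ ∀ s t, ‖Z l ω t - Z l ω s‖ ≤ R * dist t s ^ β} ≤ δ)
    (hZ : ∀ δ : ℝ≥0∞, 0 < δ → ∃ K : Set C(cube T m, EuclideanSpace ℝ (Fin p)), IsCompact K ∧
      ∀ l, capacity 𝒬 {ω | Z l ω ∉ K} ≤ δ)
    (hlim : ∀ t, ∀ δ : ℝ, 0 < δ →
      Tendsto (fun ε => ⨆ l, capacity 𝒬 {ω | δ ≤ ‖Y l ε ω t - Z l ω t‖}) ℱ (𝓝 0))
    (Φ : C(cube T m, EuclideanSpace ℝ (Fin p)) →ᵇ ℝ) :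
    Tendsto (fun ε => ⨆ l, gExp 𝒬 (fun ω => |Φ (Y l ε ω) - Φ (Z l ω)|)) ℱ (𝓝 0) := by
  suffices H : ∀ η : ℝ, 0 < η →
      ∀ᶠ ε in ℱ, (⨆ l, gExp 𝒬 (fun ω => |Φ (Y l ε ω) - Φ (Z l ω)|)) ≤ η by
    refine Metric.tendsto_nhds.2 fun η hη => ?_
    filter_upwards [H (η / 2) (half_pos hη)] with ε hε
    rw [Real.dist_0_eq_abs,
      abs_of_nonneg (Real.iSup_nonneg fun l => gExp_nonneg fun _ => abs_nonneg _)]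
    linarith
  intro η hη
  have hM0 : 0 ≤ ‖Φ‖ := norm_nonneg Φ
  -- Four exceptional sets of capacity at most `δ`, on which the integrand is at most `2 ‖Φ‖`,
  -- contribute `8 ‖Φ‖ δ ≤ η / 2`.
  set δ : ℝ := η / (16 * (‖Φ‖ + 1)) with hδ
  have hδ0 : 0 < δ := by positivity
  have hδ0' : 0 < ENNReal.ofReal δ := ENNReal.ofReal_pos.2 hδ0
  obtain ⟨K, hK, hKδ⟩ := hZ _ hδ0'
  obtain ⟨R, -, hR⟩ := hY _ hδ0'
  -- This form of uniform continuity requires only one of the two paths to lie in `K`, so tightness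
  -- of the limits suffices.
  obtain ⟨r, hr, hrΦ⟩ := Metric.mem_uniformity_dist.1
    (hK.uniformContinuousAt_of_continuousAt Φ (fun _ _ => Φ.continuous.continuousAt)
      (Metric.dist_mem_uniformity (half_pos hη)))
  obtain ⟨F, hF⟩ := exists_finset_dist_lt (p := p) (T := T) (m := m) dense_univ R hβ hr
  have hsum := tendsto_finsetSum F fun t _ => hlim t (r / 4) (by positivity)
  rw [Finset.sum_const_zero] at hsum
  filter_upwards [hsum.eventually (gt_mem_nhds hδ0')] with ε hε
  refine Real.iSup_le (fun l => gExp_le_of_upperExp_le (fun _ => abs_nonneg _)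
    (((measurable_comp_continuous (hYm l ε) Φ.continuous).sub
      (measurable_comp_continuous (hZm l) Φ.continuous)).abs) hη.le ?_) hη.le
  set A := ({ω | Z l ω ∉ K} ∪ {ω | ¬ ∀ s t, ‖Y l ε ω t - Y l ε ω s‖ ≤ R * dist t s ^ β}) ∪
    ({ω | ¬ ∀ s t, ‖Z l ω t - Z l ω s‖ ≤ R * dist t s ^ β} ∪
      ⋃ t ∈ F, {ω | r / 4 ≤ ‖Y l ε ω t - Z l ω t‖}) with hA
  have hAcap : capacity 𝒬 A ≤ ENNReal.ofReal (4 * δ) := by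
    have h1 : capacity 𝒬 (⋃ t ∈ F, {ω | r / 4 ≤ ‖Y l ε ω t - Z l ω t‖}) ≤ ENNReal.ofReal δ :=
      (capacity_biUnion_finset_le F _).trans ((Finset.sum_le_sum fun t _ =>
        le_iSup (fun l => capacity 𝒬 {ω | r / 4 ≤ ‖Y l ε ω t.1 - Z l ω t.1‖}) l).trans hε.le)
    calc capacity 𝒬 A ≤ (ENNReal.ofReal δ + ENNReal.ofReal δ) +
          (ENNReal.ofReal δ + ENNReal.ofReal δ) :=
          (capacity_union_le _ _).trans (add_le_add
            ((capacity_union_le _ _).trans (add_le_add (hKδ l) ((hR l).1 ε)))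
            ((capacity_union_le _ _).trans (add_le_add (hR l).2 h1)))
      _ = ENNReal.ofReal (4 * δ) := by
          rw [← ENNReal.ofReal_add hδ0.le hδ0.le,
            ← ENNReal.ofReal_add (by positivity) (by positivity)]
          congr 1
          ring
  refine (upperExp_le_add_mul_capacity (A := A) (a := ENNReal.ofReal (η / 2))
    (b := ENNReal.ofReal (2 * ‖Φ‖)) (fun ω hω => ENNReal.ofReal_le_ofReal ?_)
    fun ω => ENNReal.ofReal_le_ofReal ?_).trans ?_
  · simp only [hA, mem_union, mem_iUnion, mem_ofPred_eq, not_or, not_not, not_exists,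
      not_le] at hω
    obtain ⟨⟨h1, h2⟩, h3, h4⟩ := hω
    have h5 := hF _ _ h2 h3 fun t ht => h4 t ht
    rw [dist_comm] at h5
    have h6 : dist (Φ (Z l ω)) (Φ (Y l ε ω)) < η / 2 := hrΦ h5 h1
    rw [dist_comm, Real.dist_eq] at h6
    exact h6.le
  · refine (abs_sub _ _).trans ?_
    have h1 := Φ.norm_coe_le_norm (Y l ε ω)
    have h2 := Φ.norm_coe_le_norm (Z l ω)
    rw [Real.norm_eq_abs] at h1 h2
    linarith
  · calc _ ≤ ENNReal.ofReal (η / 2) + ENNReal.ofReal (2 * ‖Φ‖) * ENNReal.ofReal (4 * δ) := by gcongr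
      _ = ENNReal.ofReal (η / 2 + 2 * ‖Φ‖ * (4 * δ)) := by
          rw [← ENNReal.ofReal_mul (by positivity),
            ← ENNReal.ofReal_add (by positivity) (by positivity)]
      _ ≤ ENNReal.ofReal η := by
          refine ENNReal.ofReal_le_ofReal ?_
          have h1 : (‖Φ‖ + 1) * δ = η / 16 := by rw [hδ]; field_simp
          nlinarith

end RandomField

/-! ### The three assertions. -/

theorem mainTheorem6 {d m p : ℕ}
    (S : Set (Matrix (Fin d) (Fin d) ℝ)) (hS : IsCovarianceSet S)
    (𝒬 : Set (ProbabilityMeasure (PathSpace d))) (hPs : RepresentsGExpectation S 𝒬)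
    {T : ℝ} (hT : 0 < T) {Λ : Type*}
    (Y : Λ → Set.Icc (0 : ℝ) 1 → PathSpace d → C(cube T m, EuclideanSpace ℝ (Fin p)))
    (hmeas : ∀ l ε t, Measurable (fun ω => Y l ε ω t))
    (hqc : ∀ l ε t, QuasiContinuous 𝒬 (fun ω => Y l ε ω t))
    (C q κ : ℝ) (hq : 0 < q) (hκ : 0 < κ)
    (hmoment : ∀ l ε s t,
      upperExp 𝒬 (fun ω => ENNReal.ofReal (‖Y l ε ω t - Y l ε ω s‖ ^ q)) ≤
        ENNReal.ofReal (C * dist t s ^ ((m : ℝ) + κ))) :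
    -- Uniform moment bound for the Hölder seminorms.
    (∀ α : ℝ, 0 ≤ α → α < κ / q →
      (⨆ l, ⨆ ε, upperExp 𝒬 (fun ω => holderSeminorm α (Y l ε ω) ^ q)) < ⊤) ∧
    -- Tightness, provided that the values at one point are tight.
    ((∃ t₀, ∀ δ : ℝ≥0∞, 0 < δ → ∃ R : ℝ, ∀ l ε, capacity 𝒬 {ω | R < ‖Y l ε ω t₀‖} ≤ δ) →
      ∀ δ : ℝ≥0∞, 0 < δ → ∃ K : Set C(cube T m, EuclideanSpace ℝ (Fin p)), IsCompact K ∧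
        (⨆ l, ⨆ ε, capacity 𝒬 {ω | Y l ε ω ∉ K}) < δ) ∧
    -- Uniform convergence in distribution, provided that the limits are tight at one point.
    ((∃ t₀, ∀ δ : ℝ≥0∞, 0 < δ → ∃ R : ℝ, ∀ l, capacity 𝒬 {ω | R < ‖Y l 0 ω t₀‖} ≤ δ) →
      (∀ t, ∀ δ : ℝ, 0 < δ →
        Tendsto (fun ε => ⨆ l, capacity 𝒬 {ω | δ ≤ ‖Y l ε ω t - Y l 0 ω t‖})
          (𝓝[≠] 0) (𝓝 0)) →
      ∀ Φ : C(cube T m, EuclideanSpace ℝ (Fin p)) →ᵇ ℝ,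
        (∀ l ε, MemLG 𝒬 (fun ω => |Φ (Y l ε ω) - Φ (Y l 0 ω)|)) ∧
        Tendsto (fun ε => ⨆ l, gExp 𝒬 (fun ω => |Φ (Y l ε ω) - Φ (Y l 0 ω)|))
          (𝓝[≠] 0) (𝓝 0)) := by
  have h𝒬 := hPs.isCompact
  have hκq : 0 < κ / q := div_pos hκ hq
  -- Tightness and convergence need just one Hölder exponent in `(0, κ / q)`; the midpoint is taken.
  have hβ : 0 < κ / q / 2 := by positivity
  have hβκ : κ / q / 2 * q < κ := by
    rw [div_mul_eq_mul_div, div_mul_cancel₀ κ hq.ne']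
    linarith
  have hhol : ∀ δ : ℝ≥0∞, 0 < δ → ∃ R : ℝ, 0 ≤ R ∧ ∀ i : Λ × Set.Icc (0 : ℝ) 1,
      capacity 𝒬 {ω | ¬ ∀ s t, ‖Y i.1 i.2 ω t - Y i.1 i.2 ω s‖ ≤ R * dist t s ^ (κ / q / 2)} ≤ δ :=
    fun δ hδ => exists_capacity_not_holder_le hT (Y := fun i : Λ × Set.Icc (0 : ℝ) 1 => Y i.1 i.2)
      (fun i => hmeas i.1 i.2) hβ hq hβκ (fun i => hmoment i.1 i.2) hδ
  refine ⟨fun α hα hακ => ?_, ?_, ?_⟩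
  -- A `β` strictly above `α` is positive even when `α = 0`, as chaining requires.
  · obtain ⟨β, hαβ, hβκ'⟩ := exists_between hακ
    have hβ0 : 0 < β := hα.trans_lt hαβ
    obtain ⟨B, hB⟩ := exists_upperExp_gridSum_le (d := d) (p := p) (m := m) (𝒬 := 𝒬) (C := C)
      hT.le ((lt_div_iff₀ hq).1 hβκ') hκ
    set c := ENNReal.ofReal (((chainingConst T β + 1) * (√m * T + 1) ^ (β - α)) ^ q)
    refine lt_of_le_of_lt (iSup_le fun l => iSup_le fun ε => ?_)
      (ENNReal.mul_lt_top (ENNReal.ofReal_lt_top : c < ⊤) (ENNReal.coe_lt_top (r := B)))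
    refine upperExp_le_iff.2 fun P hP => ?_
    calc _ ≤ ∫⁻ ω, c * gridSum hT.le β q (Y l ε ω) ∂(P : Measure (PathSpace d)) :=
          lintegral_mono fun ω => holderSeminorm_rpow_le_gridSum hT hαβ.le hβ0 hq (Y l ε ω)
      _ = c * ∫⁻ ω, gridSum hT.le β q (Y l ε ω) ∂(P : Measure (PathSpace d)) :=
          lintegral_const_mul _ (measurable_gridSum hT.le β q (hmeas l ε))
      _ ≤ c * B := by
          gcongr
          exact (lintegral_le_upperExp hP _).trans (hB _ (hmeas l ε) (hmoment l ε))
  · rintro ⟨t₀, ht₀⟩ δ hδ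
    obtain ⟨δ', hδ', hδδ⟩ := exists_between hδ
    obtain ⟨K, hK, hKδ⟩ := exists_isCompact_capacity_notMem_le hβ hhol (t₀ := t₀)
      (fun δ hδ => (ht₀ δ hδ).imp fun R hR i => hR i.1 i.2) hδ'
    exact ⟨K, hK, (iSup_le fun l => iSup_le fun ε => hKδ (l, ε)).trans_lt hδδ⟩
  · rintro ⟨t₀, ht₀⟩ hlim Φ
    have hhol₀ : ∀ δ : ℝ≥0∞, 0 < δ → ∃ R : ℝ, 0 ≤ R ∧ ∀ l,
        capacity 𝒬 {ω | ¬ ∀ s t, ‖Y l 0 ω t - Y l 0 ω s‖ ≤ R * dist t s ^ (κ / q / 2)} ≤ δ :=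
      fun δ hδ => (hhol δ hδ).imp fun R hR => ⟨hR.1, fun l => hR.2 (l, 0)⟩
    have hqc' (l : Λ) (ε : Set.Icc (0 : ℝ) 1) : QuasiContinuous 𝒬 (Y l ε) :=
      quasiContinuous_of_forall_eval (hqc l ε) hβ
        fun δ hδ => (hhol δ hδ).imp fun R hR => ⟨hR.1, hR.2 (l, ε)⟩
    refine ⟨fun l ε => ?_, ?_⟩
    · refine QuasiContinuous.memLG h𝒬 (M := 2 * ‖Φ‖)
        ((measurable_comp_continuous (hmeas l ε) Φ.continuous).sub
          (measurable_comp_continuous (hmeas l 0) Φ.continuous)).abs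
        ((hqc' l ε).comp₂ (hqc' l 0) (f := fun y z => |Φ y - Φ z|) (by fun_prop)) fun ω => ?_
      have h1 := Φ.dist_le_two_norm (Y l ε ω) (Y l 0 ω)
      rwa [abs_abs, ← Real.dist_eq]
    · exact tendsto_iSup_gExp_abs_sub hmeas (fun l => hmeas l 0) hβ
        (fun δ hδ => (hhol δ hδ).imp fun R hR => ⟨hR.1, fun l => ⟨fun ε => hR.2 (l, ε),
          hR.2 (l, 0)⟩⟩)
        (fun δ hδ => exists_isCompact_capacity_notMem_le hβ hhol₀ ht₀ hδ) hlim Φ
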